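/- **Setting.** Let $\mathcal C\subset\mathbb R^n$ be compact with $0\in\mathrm{Int}\,\mathcal C$, and consider $\dot x=f(x,\theta)+g(x)u$, $f(x,\theta)=Y(x)\theta$, with $Y,g$ continuous and $\theta\in\mathbb R^p$ unknown. Let $r(x,u)=Q(x)+\tfrac12u^TRu$ with $Q\ge0$, $Q(0)=0$, $R$ symmetric positive definite. Let $B_f:\mathrm{Int}\,\mathcal C\to\mathbb R$ be $C^1$ with $B_f(0)=0$, $B_f(x)>0$ for $x\ne0$, $B_f(x)\to\infty$ as $x\to\partial\mathcal C$, and $B_f\le\gamma\|\nabla B_f\|$ on $\mathrm{Int}\,\mathcal C$ for some $\gamma>0$. With $R_g=gR^{-1}g^T$ assume $\lambda_{\min}(R_g)>l_g>0$ and $\|R_g\|\le\overline R_g$ on $\mathcal C$. Put $R_{bf}=\nabla B_f^TR_g\nabla B_f$. Let $L^*$ be a $C^1$ solution on $\mathrm{Int}\,\mathcal C$, with $L^*(0)=0$, of the constrained HJB equation $0=\min_u[r(x,u)+\lambda^*\nabla B_f^T(f+gu)+\nabla L^{*T}(f+gu)]$, where $\lambda^*=\max\big((\nabla B_f^Tf-\nabla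 B_f^TR_g\nabla L^*)/R_{bf},0\big)$ if $\nabla B_f\ne0$ and $\lambda^*=0$ otherwise. On a compact $\mathcal D\supseteq\mathcal C$ let $L^*=W^T\phi+\epsilon$, with $\phi:\mathcal D\to\mathbb R^b$ and $\epsilon$ of class $C^1$ on a neighbourhood of $\mathcal D$, $\phi(0)=0$, $\nabla\phi(0)=0$, and $\epsilon,\nabla\epsilon$ bounded on $\mathcal D$. Put $R_s=\nabla\phi R_g\nabla\phi^T$. **Update laws.** All gains $k,k_{sb},\nu,\beta,\eta_{c1},\eta_{c2},\eta_{a1},\eta_{a2},\overline W_a$ are positive. With $\sigma(z)=k\ln(1+e^{z/k})$ and $\varsigma=2\ln(2)\overline R_g/l_g+1$, let $$\hat\lambda=\sigma\Big(\frac{\nabla B_f^TY\hat\theta-\nabla B_f^TR_g\nabla\phi^T\hat W_a}{R_{bf}+k_{sb}}\Big)+k\varsigma,\qquad \hat u=-R^{-1}g^T[\nabla\phi^T\hat W_a+\hat\lambda\nabla B_f],$$ $$\delta=r(x,\hat u)+(\nabla\phi^T\hat W_c+\hat\lambda\nabla B_f)^T[Y\hat\theta+g\hat u],\quad \omega=\partial\delta/\partial\hat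 W_c,\quad \rho=\sqrt{1+\nu\,\omega^T\Gamma\omega},\quad \psi=\omega\omega^T/\rho^2,$$ and let $\delta_i,\omega_i,\rho_i,\psi_i,R_{si}$ be the same quantities at the extrapolation points $x_i(t)=X_i(x(t),t)$, $i=1,\dots,N$, where the maps $X_i$ take values in a fixed compact subset of $\mathrm{Int}\,\mathcal C$. The closed loop consists of the plant with $u=\hat u$ and $$\dot{\hat W}_c=-\eta_{c1}\Gamma\frac{\omega}{\rho^2}\delta-\frac{\eta_{c2}}N\Gamma\sum_i\frac{\omega_i}{\rho_i^2}\delta_i,\qquad \dot\Gamma=\beta\Gamma-\eta_{c1}\Gamma\psi\Gamma-\frac{\eta_{c2}}N\Gamma\sum_i\psi_i\Gamma,$$ $$\dot{\hat W}_a=\mathrm{proj}\Big(\eta_{a1}(\hat W_c-\hat W_a)-\eta_{a2}\hat W_a+\eta_{c1}\frac{R_s^T\hat W_a\omega^T}{4\rho}\hat W_c+\frac{\eta_{c2}}N\sum_i\frac{R_{si}^T\hat W_a\omega_i^T}{4\rho_i}\hat W_c\Big),$$ where $\Gamma(t_0)=\Gamma_0$ is symmetric positive definite, $\mathrm{proj}$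 is the standard continuous projection operator for the ball of radius $\overline W_a$ (with a tolerance $\varepsilon_0>0$, namely $\mathrm{proj}(y)=y-h\,\frac{\hat W_a\hat W_a^T}{\|\hat W_a\|^2}y$ if $h:=\frac{(1+\varepsilon_0)\|\hat W_a\|^2-\overline W_a^2}{\varepsilon_0\overline W_a^2}>0$ and $\hat W_a^Ty>0$, and $\mathrm{proj}(y)=y$ otherwise), and $\|\hat W_a(t_0)\|\le\overline W_a$. The identifier $\hat\theta$ is any continuous parameter estimate that admits a Lyapunov function $V_\theta(\tilde\theta,t)$ with $\underline\alpha(\|\tilde\theta\|)\le V_\theta\le\overline\alpha(\|\tilde\theta\|)$, where $\underline\alpha\in\mathcal K_\infty$ and $\overline\alpha\in\mathcal K$, and $\dot V_\theta\le-k_\theta\|\tilde\theta\|^2$ along the trajectory, with $k_\theta>0$. Write $\tilde W_c=W-\hat W_c$, $\tilde W_a=W-\hat W_a$, $\tilde\theta=\theta-\hat\theta$. **Excitation.** For some $T>0$ and $c_1,c_2,c_3\ge0$, not all zero, and for all $t\ge t_0$: $c_1\mathbb I\preccurlyeq\int_t^{t+T}\psi\,d\tau$, $c_2\mathbb I\preccurlyeq\frac1N\sum_i\psi_i(t)$,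 $c_3\mathbb I\preccurlyeq\frac1N\int_t^{t+T}\sum_i\psi_i\,d\tau$. **Cross-terms.** With $\underline\Gamma=\inf_t\lambda_{\min}(\Gamma(t))$, $\overline\Gamma=\sup_t\lambda_{\max}(\Gamma(t))$, $\underline c=\frac{c_2}2+\frac{\beta}{2\eta_{c2}\overline\Gamma}$, $\varphi_{ci}=\frac{\eta_{c1}+\eta_{c2}}{2\sqrt{\nu\underline\Gamma}}\sup_{\mathrm{Int}\,\mathcal C}\big\|\,\|W\|\nabla\phi Y\big\|$ and $\varphi_{ca}=\eta_{a1}+\frac{\eta_{c1}+\eta_{c2}}{4\sqrt{\nu\underline\Gamma}}\sup_{\mathrm{Int}\,\mathcal C}\|R_s\overline W_a\|$, let $$S=\begin{bmatrix}\frac{\eta_{c2}\underline c}4&-\frac{\varphi_{ca}}2&-\frac{\varphi_{ci}}2\\-\frac{\varphi_{ca}}2&\frac{\eta_{a1}+\eta_{a2}}4&0\\-\frac{\varphi_{ci}}2&0&\frac{k_\theta}4\end{bmatrix}.$$ **Theorem.** (a) Every closed-loop trajectory with $x(t_0)\in\mathrm{Int}\,\mathcal C$ (equivalently, $B_f(x(t_0))<\infty$)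 satisfies $x(t)\in\mathrm{Int}\,\mathcal C$ for as long as it is defined, so $\mathcal C$ is forward invariant, and the state is bounded, uniformly over all trajectories. (b) On the trajectories that satisfy the excitation conditions and $S\succcurlyeq0$, the errors $\tilde W_c,\tilde W_a,\tilde\theta$ are uniformly ultimately bounded: there is $\bar b>0$ such that for every compact $K\subset\mathrm{Int}\,\mathcal C$ and every $a>0$ there is $T_u\ge0$, independent of $t_0\ge0$ and of the trajectory, such that if $x(t_0)\in K$ and $\|\tilde W_c(t_0)\|,\|\tilde W_a(t_0)\|,\|\tilde\theta(t_0)\|\le a$, then $\|\tilde W_c(t)\|,\|\tilde W_a(t)\|,\|\tilde\theta(t)\|\le\bar b$ for all $t\ge t_0+T_u$ for which the trajectory is defined. -/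

import Mathlib

open Set Filter Topology MeasureTheory
open scoped RealInnerProductSpace InnerProductSpace

noncomputable section

/-- Euclidean space `ℝᵈ` with its Euclidean norm. -/
abbrev Vec (d : ℕ) : Type := EuclideanSpace ℝ (Fin d)

/-- Linear maps `ℝᵈ → ℝᵉ` (that is, `e × d` matrices) with the induced (spectral) norm;
the transpose is `ContinuousLinearMap.adjoint`. -/
abbrev Lin (d e : ℕ) : Type := Vec d →L[ℝ] Vec e

/-- Symmetric positive definite square matrices. -/
def IsPosDefMap {d : ℕ} (A : Lin d d) : Prop :=
  IsSelfAdjoint A ∧ ∀ v : Vec d, v ≠ 0 → 0 < ⟪A v, v⟫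

/-- The outer product `ω ωᵀ`. -/
def outer {d : ℕ} (ω : Vec d) : Lin d d := InnerProductSpace.rankOne ℝ ω ω

/-- Softplus with gain `k`: `σ(z) = k ln (1 + exp (z / k))`. -/
def softplus (k z : ℝ) : ℝ := k * Real.log (1 + Real.exp (z / k))

/-- Comparison functions of class `𝒦` on `[0, ∞)`. -/
structure IsClassK (α : ℝ → ℝ) : Prop where
  continuousOn : ContinuousOn α (Ici 0)
  strictMonoOn : StrictMonoOn α (Ici 0)
  zero : α 0 = 0

/-- Comparison functions of class `𝒦_∞`. -/
structure IsClassKInfty (α : ℝ → ℝ) : Prop extends IsClassK α where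
  unbounded : Tendsto α atTop atTop

/-- The convex function of the projection operator: it is `≤ 1` exactly on the ball of radius
`r`, and `≤ 0` exactly on the ball of radius `r / √(1 + tol)`. -/
def projFun {d : ℕ} (r tol : ℝ) (w : Vec d) : ℝ :=
  ((1 + tol) * ‖w‖ ^ 2 - r ^ 2) / (tol * r ^ 2)

/-- The standard (continuous) projection operator of adaptive control for `projFun`:
`proj(w, y) = y - f(w) (∇f ∇fᵀ / ‖∇f‖²) y` if `f(w) > 0` and `yᵀ ∇f > 0`, and `y` otherwise.
Here `∇f(w)` is a positive multiple of `w`. -/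
def proj {d : ℕ} (r tol : ℝ) (w y : Vec d) : Vec d :=
  open Classical in
  if 0 < projFun r tol w ∧ 0 < ⟪w, y⟫ then
    y - (projFun r tol w * (⟪w, y⟫ / ‖w‖ ^ 2)) • w
  else y

/-- The time interval `[t₀, t₁)`, where `t₁ = ⊤` gives `[t₀, ∞)`. -/
def horizon (t₀ : ℝ) (t₁ : EReal) : Set ℝ := {t | t₀ ≤ t ∧ (t : EReal) < t₁}

/-- The data: plant, constraint set, barrier, cost, basis functions, extrapolation maps, gains. -/
structure ACIL (n m p b N : ℕ) where
  /-- the constraint set `𝒞` -/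
  C : Set (Vec n)
  /-- the compact set `𝒟 ⊇ 𝒞` on which the basis functions are used -/
  D : Set (Vec n)
  /-- the regressor, `f(x, θ) = Y(x) θ` -/
  Y : Vec n → Lin p n
  /-- the true, unknown parameter -/
  θ : Vec p
  /-- the control effectiveness matrix -/
  g : Vec n → Lin m n
  /-- the candidate barrier function `B_f`; only its values on `Int 𝒞` matter -/
  B : Vec n → ℝ
  /-- the state cost -/
  Q : Vec n → ℝ
  /-- the control weight -/
  R : Lin m m
  /-- the basis functions -/
  φ : Vec n → Vec b
  /-- the Bellman extrapolation maps -/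
  X : Fin N → Vec n → ℝ → Vec n
  /-- the constants `γ`, `l_g` and `R̄_g` -/
  γ : ℝ
  lg : ℝ
  Rgbar : ℝ
  /-- softplus gain and denominator offset -/
  k : ℝ
  ksb : ℝ
  /-- learning gains, normalization gain, forgetting factor -/
  ηc1 : ℝ
  ηc2 : ℝ
  ηa1 : ℝ
  ηa2 : ℝ
  ν : ℝ
  β : ℝ
  /-- initial least squares gain -/
  Γ₀ : Lin b b
  /-- radius and tolerance of the projection operator -/
  Wabar : ℝ
  tol : ℝ

namespace ACIL

variable {n m p b N : ℕ} (P : ACIL n m p b N)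

/-- Drift `f(x, ϑ) = Y(x) ϑ`. -/
def f (x : Vec n) (ϑ : Vec p) : Vec n := P.Y x ϑ

/-- `R_g(x) = g(x) R⁻¹ g(x)ᵀ`. -/
def Rg (x : Vec n) : Lin n n :=
  P.g x ∘L P.R.inverse ∘L (ContinuousLinearMap.adjoint (P.g x))

/-- Instantaneous cost `r(x, u) = Q(x) + ½ uᵀ R u`. -/
def r (x : Vec n) (u : Vec m) : ℝ := P.Q x + 1 / 2 * ⟪u, P.R u⟫

/-- `∇B_f(x)`. -/
def gradB (x : Vec n) : Vec n := gradient P.B x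

/-- `R_bf(x) = ∇B_fᵀ R_g ∇B_f`. -/
def Rbf (x : Vec n) : ℝ := ⟪P.gradB x, P.Rg x (P.gradB x)⟫

/-- The Jacobian `∇φ(x)`, a `b × n` matrix. -/
def Dφ (x : Vec n) : Lin n b := fderiv ℝ P.φ x

/-- The transposed Jacobian `∇φ(x)ᵀ`. -/
def DφT (x : Vec n) : Lin b n := ContinuousLinearMap.adjoint (P.Dφ x)

/-- `R_s(x) = ∇φ R_g ∇φᵀ`. -/
def Rs (x : Vec n) : Lin b b := P.Dφ x ∘L P.Rg x ∘L P.DφT x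

/-- Standing assumptions on the data. -/
structure Standing : Prop where
  isCompact_C : IsCompact P.C
  zero_mem : (0 : Vec n) ∈ interior P.C
  isCompact_D : IsCompact P.D
  C_subset_D : P.C ⊆ P.D
  continuous_Y : Continuous P.Y
  continuous_g : Continuous P.g
  -- candidate barrier Lyapunov function
  B_contDiff : ContDiffOn ℝ 1 P.B (interior P.C)
  B_zero : P.B 0 = 0
  B_pos : ∀ x ∈ interior P.C, x ≠ 0 → 0 < P.B x
  B_tendsto : ∀ y ∈ frontier P.C, Tendsto P.B (𝓝[interior P.C] y) atTop
  γ_pos : 0 < P.γ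
  B_le_grad : ∀ x ∈ interior P.C, P.B x ≤ P.γ * ‖P.gradB x‖
  -- cost
  Q_zero : P.Q 0 = 0
  Q_nonneg : ∀ x, 0 ≤ P.Q x
  R_posDef : IsPosDefMap P.R
  -- control effectiveness: `λ_min (R_g) > l_g` and `‖R_g‖ ≤ R̄_g` on `𝒞`
  lg_pos : 0 < P.lg
  Rgbar_pos : 0 < P.Rgbar
  Rg_lower : ∀ x ∈ P.C, ∀ v : Vec n, v ≠ 0 → P.lg * ‖v‖ ^ 2 < ⟪P.Rg x v, v⟫
  Rg_upper : ∀ x ∈ P.C, ‖P.Rg x‖ ≤ P.Rgbar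
  -- basis functions, continuously differentiable on a neighbourhood of `𝒟`
  φ_contDiff : ∀ x ∈ P.D, ContDiffAt ℝ 1 P.φ x
  φ_zero : P.φ 0 = 0
  Dφ_zero : P.Dφ 0 = 0
  -- the extrapolation points stay in the interior of `𝒞`, away from its boundary
  X_mem : ∃ K : Set (Vec n), IsCompact K ∧ K ⊆ interior P.C ∧
    ∀ i, ∀ x ∈ interior P.C, ∀ t, 0 ≤ t → P.X i x t ∈ K
  -- gains
  k_pos : 0 < P.k
  ksb_pos : 0 < P.ksb
  ηc1_pos : 0 < P.ηc1
  ηc2_pos : 0 < P.ηc2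
  ηa1_pos : 0 < P.ηa1
  ηa2_pos : 0 < P.ηa2
  ν_pos : 0 < P.ν
  β_pos : 0 < P.β
  Γ₀_posDef : IsPosDefMap P.Γ₀
  Wabar_pos : 0 < P.Wabar
  tol_pos : 0 < P.tol

/-! The constrained optimal control problem and its value function. -/

/-- `C_s^*(x) = ∇B_fᵀ f(x, θ) - ∇B_fᵀ R_g ∇L^*`. -/
def CsStar (L : Vec n → ℝ) (x : Vec n) : ℝ :=
  ⟪P.gradB x, P.f x P.θ⟫ - ⟪P.gradB x, P.Rg x (gradient L x)⟫

/-- The optimal Lagrange multiplier `λ^*`. -/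
def lamStar (L : Vec n → ℝ) (x : Vec n) : ℝ :=
  open Classical in
  if P.gradB x ≠ 0 then max (P.CsStar L x / P.Rbf x) 0 else 0

/-- `r(x, u) + λ ∇B_fᵀ (f + g u) + ∇Lᵀ (f + g u)`. -/
def hamiltonian (L : Vec n → ℝ) (x : Vec n) (u : Vec m) (lam : ℝ) : ℝ :=
  P.r x u + lam * ⟪P.gradB x, P.f x P.θ + P.g x u⟫
    + ⟪gradient L x, P.f x P.θ + P.g x u⟫

/-- `L` is a continuously differentiable solution on `Int 𝒞` of the constrained
Hamilton-Jacobi-Bellman equation `0 = min_u [r + λ^* ∇B_fᵀ (f + g u) + ∇Lᵀ (f + g u)]`, with the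
Karush-Kuhn-Tucker multiplier `λ^*`. -/
structure SolvesHJB (L : Vec n → ℝ) : Prop where
  contDiff : ContDiffOn ℝ 1 L (interior P.C)
  zero : L 0 = 0
  hjb : ∀ x ∈ interior P.C, IsLeast (range fun u : Vec m => P.hamiltonian L x u (P.lamStar L x)) 0

/-- `L = Wᵀ φ + ε` on `𝒟`, where `ε` and `∇ε` are bounded on `𝒟`. -/
structure IsIdealWeight (L : Vec n → ℝ) (W : Vec b) (ε : Vec n → ℝ) : Prop where
  eq : ∀ x ∈ P.D, L x = ⟪W, P.φ x⟫ + ε x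
  contDiff : ∀ x ∈ P.D, ContDiffAt ℝ 1 ε x
  bound : ∃ εbar, 0 < εbar ∧ ∀ x ∈ P.D, |ε x| ≤ εbar
  bound_grad : ∃ εd, 0 < εd ∧ ∀ x ∈ P.D, ‖gradient ε x‖ ≤ εd

/-! The online estimates. -/

/-- `ς = 2 ln 2 · R̄_g / l_g + 1`. -/
def varsig : ℝ := 2 * Real.log 2 * P.Rgbar / P.lg + 1

/-- `Ĉ_s(x, Ŵ_a, θ̂)`. -/
def CsHat (x : Vec n) (wa : Vec b) (ϑ : Vec p) : ℝ :=
  ⟪P.gradB x, P.f x ϑ⟫ - ⟪P.gradB x, P.Rg x (P.DφT x wa)⟫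

/-- The estimate `λ̂` of the Lagrange multiplier. -/
def lamHat (x : Vec n) (wa : Vec b) (ϑ : Vec p) : ℝ :=
  softplus P.k (P.CsHat x wa ϑ / (P.Rbf x + P.ksb)) + P.k * P.varsig

/-- The control law `û = -R⁻¹ gᵀ [∇φᵀ Ŵ_a + λ̂ ∇B_f]`. -/
def uHat (x : Vec n) (wa : Vec b) (ϑ : Vec p) : Vec m :=
  -(P.R.inverse (ContinuousLinearMap.adjoint (P.g x)
    (P.DφT x wa + P.lamHat x wa ϑ • P.gradB x)))

/-- The value function estimate `L̂(x, Ŵ_c) = Ŵ_cᵀ φ(x)`. -/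
def LHat (wc : Vec b) (x : Vec n) : ℝ := ⟪wc, P.φ x⟫

/-- The Bellman error `δ(x, Ŵ_c, Ŵ_a, θ̂)`. -/
def bellman (x : Vec n) (wc wa : Vec b) (ϑ : Vec p) : ℝ :=
  P.r x (P.uHat x wa ϑ)
    + ⟪gradient (P.LHat wc) x + P.lamHat x wa ϑ • P.gradB x,
        P.f x ϑ + P.g x (P.uHat x wa ϑ)⟫

/-- `ω = ∂δ / ∂Ŵ_c`. -/
def omega (x : Vec n) (wc wa : Vec b) (ϑ : Vec p) : Vec b :=
  gradient (fun w => P.bellman x w wa ϑ) wc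

end ACIL

/-- The signals of the closed loop: state, critic, actor, least squares gain, identifier. -/
structure Signals (n p b : ℕ) where
  x : ℝ → Vec n
  Wc : ℝ → Vec b
  Wa : ℝ → Vec b
  Γ : ℝ → Lin b b
  θh : ℝ → Vec p

namespace ACIL

variable {n m p b N : ℕ} (P : ACIL n m p b N) (s : Signals n p b)

/-- The `i`-th extrapolation point `x_i(t) = X_i(x(t), t)`. -/
def pt (i : Fin N) (t : ℝ) : Vec n := P.X i (s.x t) t

/-- `δ` at the point `y`, with the estimates at time `t`. -/
def del (y : Vec n) (t : ℝ) : ℝ := P.bellman y (s.Wc t) (s.Wa t) (s.θh t)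

/-- `ω` at the point `y`, with the estimates at time `t`. -/
def om (y : Vec n) (t : ℝ) : Vec b := P.omega y (s.Wc t) (s.Wa t) (s.θh t)

/-- `ρ = √(1 + ν ωᵀ Γ ω)` at the point `y`, with the estimates at time `t`. -/
def rho (y : Vec n) (t : ℝ) : ℝ :=
  Real.sqrt (1 + P.ν * ⟪P.om s y t, s.Γ t (P.om s y t)⟫)

/-- `ψ = ω ωᵀ / ρ²` at the point `y`, with the estimates at time `t`. -/
def psi (y : Vec n) (t : ℝ) : Lin b b := (1 / P.rho s y t ^ 2) • outer (P.om s y t)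

/-- Right-hand side of the critic update law. -/
def criticRHS (t : ℝ) : Vec b :=
  -((P.ηc1 * P.del s (s.x t) t / P.rho s (s.x t) t ^ 2) • s.Γ t (P.om s (s.x t) t))
    - (P.ηc2 / N) • s.Γ t
        (∑ i, (P.del s (P.pt s i t) t / P.rho s (P.pt s i t) t ^ 2) • P.om s (P.pt s i t) t)

/-- Right-hand side of the update law of the least squares gain. -/
def gainRHS (t : ℝ) : Lin b b :=
  P.β • s.Γ t - P.ηc1 • (s.Γ t ∘L P.psi s (s.x t) t ∘L s.Γ t)
    - (P.ηc2 / N) • (s.Γ t ∘L (∑ i, P.psi s (P.pt s i t) t) ∘L s.Γ t)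

/-- The term `R_sᵀ Ŵ_a ωᵀ Ŵ_c / (4 ρ)` of the actor law at the point `y`. -/
def actorTerm (y : Vec n) (t : ℝ) : Vec b :=
  (⟪P.om s y t, s.Wc t⟫ / (4 * P.rho s y t)) • ContinuousLinearMap.adjoint (P.Rs y) (s.Wa t)

/-- Right-hand side of the actor update law. -/
def actorRHS (t : ℝ) : Vec b :=
  proj P.Wabar P.tol (s.Wa t)
    (P.ηa1 • (s.Wc t - s.Wa t) - P.ηa2 • s.Wa t
      + P.ηc1 • P.actorTerm s (s.x t) t
      + (P.ηc2 / N) • ∑ i, P.actorTerm s (P.pt s i t) t)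

/-- `s` is a closed-loop trajectory on `[t₀, t₁)` started in `Int 𝒞`. The signals are continuous,
and at each time until which the state has remained in `Int 𝒞` (the closed loop is not defined
elsewhere) the plant and the update laws hold with right derivatives. Classical solutions are
included, and the state is not required to remain in `𝒞`. The identifier is specified
separately. -/
structure IsTrajectory (t₀ : ℝ) (t₁ : EReal) : Prop where
  x_cont : ContinuousOn s.x (horizon t₀ t₁)
  Wc_cont : ContinuousOn s.Wc (horizon t₀ t₁)
  Wa_cont : ContinuousOn s.Wa (horizon t₀ t₁)
  Γ_cont : ContinuousOn s.Γ (horizon t₀ t₁)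
  θh_cont : ContinuousOn s.θh (horizon t₀ t₁)
  x_init : s.x t₀ ∈ interior P.C
  Wa_init : ‖s.Wa t₀‖ ≤ P.Wabar
  Γ_init : s.Γ t₀ = P.Γ₀
  plant : ∀ t ∈ horizon t₀ t₁, (∀ τ ∈ Icc t₀ t, s.x τ ∈ interior P.C) →
    HasDerivWithinAt s.x
      (P.f (s.x t) P.θ + P.g (s.x t) (P.uHat (s.x t) (s.Wa t) (s.θh t))) (Ici t) t
  critic : ∀ t ∈ horizon t₀ t₁, (∀ τ ∈ Icc t₀ t, s.x τ ∈ interior P.C) →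
    HasDerivWithinAt s.Wc (P.criticRHS s t) (Ici t) t
  gain : ∀ t ∈ horizon t₀ t₁, (∀ τ ∈ Icc t₀ t, s.x τ ∈ interior P.C) →
    HasDerivWithinAt s.Γ (P.gainRHS s t) (Ici t) t
  actor : ∀ t ∈ horizon t₀ t₁, (∀ τ ∈ Icc t₀ t, s.x τ ∈ interior P.C) →
    HasDerivWithinAt s.Wa (P.actorRHS s t) (Ici t) t

/-- Specification of the identifier: any parameter update for which there is a Lyapunov function
`V_θ(θ̃, t)`, with class `𝒦_∞` lower and class `𝒦` upper bound, whose derivative along the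
trajectory satisfies `V̇_θ ≤ -k_θ ‖θ̃‖²`, where `θ̃ = θ - θ̂`. -/
def IsIdentified (αlo αhi : ℝ → ℝ) (kθ : ℝ) (t₀ : ℝ) (t₁ : EReal) : Prop :=
  ∃ V : Vec p → ℝ → ℝ,
    (∀ z : Vec p, ∀ t ∈ horizon t₀ t₁, αlo ‖z‖ ≤ V z t ∧ V z t ≤ αhi ‖z‖) ∧
    ContinuousOn (fun t => V (P.θ - s.θh t) t) (horizon t₀ t₁) ∧
    ∀ t ∈ horizon t₀ t₁, ∃ d : ℝ, d ≤ -kθ * ‖P.θ - s.θh t‖ ^ 2 ∧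
      HasDerivWithinAt (fun τ => V (P.θ - s.θh τ) τ) d (Ici t) t

/-- Excitation conditions with window length `T` and constants `c₁, c₂, c₃` (in the semidefinite
order). -/
structure IsExciting (T c₁ c₂ c₃ : ℝ) (t₀ : ℝ) (t₁ : EReal) : Prop where
  traj : ∀ t, t₀ ≤ t → t + T ∈ horizon t₀ t₁ →
    c₁ • (1 : Lin b b) ≤ ∫ τ in t..(t + T), P.psi s (s.x τ) τ
  inst : ∀ t ∈ horizon t₀ t₁,
    c₂ • (1 : Lin b b) ≤ (1 / (N : ℝ)) • ∑ i, P.psi s (P.pt s i t) t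
  extrap : ∀ t, t₀ ≤ t → t + T ∈ horizon t₀ t₁ →
    c₃ • (1 : Lin b b) ≤ (1 / (N : ℝ)) • ∫ τ in t..(t + T), ∑ i, P.psi s (P.pt s i τ) τ

/-- The largest `c` with `c 𝕀 ≼ Γ(t)` on `[t₀, t₁)`. -/
def gainLo (s : Signals n p b) (t₀ : ℝ) (t₁ : EReal) : ℝ :=
  sSup {c : ℝ | ∀ t ∈ horizon t₀ t₁, c • (1 : Lin b b) ≤ s.Γ t}

/-- The smallest `c` with `Γ(t) ≼ c 𝕀` on `[t₀, t₁)`. -/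
def gainHi (s : Signals n p b) (t₀ : ℝ) (t₁ : EReal) : ℝ :=
  sInf {c : ℝ | ∀ t ∈ horizon t₀ t₁, s.Γ t ≤ c • (1 : Lin b b)}

/-- `sup` over `Int 𝒞`. -/
def supC (h : Vec n → ℝ) : ℝ := sSup (h '' interior P.C)

/-- `φ_ci`, as a function of the lower bound of the gain matrix. -/
def coefCI (W : Vec b) (Γlo : ℝ) : ℝ :=
  (P.ηc1 + P.ηc2) / (2 * Real.sqrt (P.ν * Γlo)) *
    P.supC fun x => ‖‖W‖ • (P.Dφ x ∘L P.Y x)‖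

/-- `φ_ca`, as a function of the lower bound of the gain matrix. -/
def coefCA (Γlo : ℝ) : ℝ :=
  P.ηa1 + (P.ηc1 + P.ηc2) / (4 * Real.sqrt (P.ν * Γlo)) * P.supC fun x => ‖P.Wabar • P.Rs x‖

/-- `c̲ = c₂ / 2 + β / (2 η_c2 Γ̄)`. -/
def cUnder (c₂ Γhi : ℝ) : ℝ := c₂ / 2 + P.β / (2 * P.ηc2 * Γhi)

/-- The matrix `S` of the coefficients of the cross-terms. -/
def crossMatrix (W : Vec b) (kθ c₂ Γlo Γhi : ℝ) : Matrix (Fin 3) (Fin 3) ℝ :=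
  !![P.ηc2 * P.cUnder c₂ Γhi / 4, -(P.coefCA Γlo / 2), -(P.coefCI W Γlo / 2);
     -(P.coefCA Γlo / 2), (P.ηa1 + P.ηa2) / 4, 0;
     -(P.coefCI W Γlo / 2), 0, kθ / 4]

end ACIL

end

/-! Safety comes from the constant offset in the multiplier estimate. Since softplus is nonnegative,
`P.lamHat` is at least `k ς > 0`, whatever the parameter estimate is. Along the plant, the
derivative of the barrier is `∇Bᵀ f - ∇Bᵀ R_g ∇φᵀ Ŵ_a - λ̂ R_bf`. The last term is at most `-k ς l_g
‖∇B‖²`, while the other two are linear in `‖∇B‖`, because the projection bounds `Ŵ_a`. As `B ≤ γ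
‖∇B‖`, a high barrier value forces a large gradient, so above a level `B₁` the barrier falls at
least at unit rate (`Standing.exists_barrier_level`). It therefore cannot blow up, and the state
cannot reach the boundary (`IsTrajectory.mem_interior`). Moreover the state enters the compact set
`B ≤ B₁` after a time controlled by the initial barrier value.

The three errors are bounded separately. The actor error is bounded by the projection. The parameter
error is bounded by the Lyapunov function of the identifier, which brings it below one in uniform
time (`exists_identifier_bound`). For the critic the Lyapunov function is `V = W̃ᵀ Γ⁻¹ W̃`. The
Riccati equation of `Γ` turns into the linear equation `(Γ⁻¹)' = -β Γ⁻¹ + M`, where `M` is the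
information rate. The Bellman error is affine in the critic weights with slope `ω`, so `δ + ωᵀ W̃`
does not involve the critic weights and is bounded by a constant `c` while the state and estimates
stay in compact sets. Completing the square then absorbs `W̃ᵀ M W̃` and gives `V' ≤ -β V + (η_c1 +
η_c2) c²` (`IsTrajectory.lyap_le`). The forgetting factor alone makes `V` decay to a fixed level.
Any one of the three excitation conditions, integrated over a window, gives `Γ⁻¹ ≥ μ > 0`
(`Standing.exists_le_inner_inverse_gain`), so that `V` controls `‖W̃‖`. -/

/-! ### One-sided differential inequalities -/

/-- Real induction on a compact interval. -/
theorem forall_mem_Icc_of_real_induction {a b : ℝ} {p : ℝ → Prop}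
    (hclosed : ∀ t ∈ Icc a b, (∀ τ ∈ Ico a t, p τ) → p t)
    (hopen : ∀ t ∈ Ico a b, (∀ τ ∈ Icc a t, p τ) → ∀ᶠ τ in 𝓝[>] t, p τ) :
    ∀ t ∈ Icc a b, p t := by
  by_contra! hne
  obtain ⟨t₂, ht₂, hpt₂⟩ := hne
  set N : Set ℝ := {t | t ∈ Icc a b ∧ ¬ p t} with hN
  have hNne : N.Nonempty := ⟨t₂, ht₂, hpt₂⟩
  have hNbdd : BddBelow N := ⟨a, fun t ht => ht.1.1⟩
  set t := sInf N with ht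
  have hat : a ≤ t := le_csInf hNne fun u hu => hu.1.1
  have htt₂ : t ≤ t₂ := csInf_le hNbdd ⟨ht₂, hpt₂⟩
  have hbefore : ∀ τ ∈ Ico a t, p τ := by
    intro τ hτ
    by_contra hp
    exact absurd (csInf_le hNbdd ⟨⟨hτ.1, by linarith [hτ.2, ht₂.2]⟩, hp⟩) (not_le.2 hτ.2)
  have hpt : p t := hclosed t ⟨hat, htt₂.trans ht₂.2⟩ hbefore
  have htlt : t < t₂ := lt_of_le_of_ne htt₂ fun h => hpt₂ (h ▸ hpt)
  have hupto : ∀ τ ∈ Icc a t, p τ := fun τ hτ =>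
    (eq_or_lt_of_le hτ.2).elim (fun h => h ▸ hpt) fun h => hbefore τ ⟨hτ.1, h⟩
  have hev := hopen t ⟨hat, htlt.trans_le ht₂.2⟩ hupto
  obtain ⟨u, htu, hu⟩ := mem_nhdsGT_iff_exists_Ioo_subset.1 hev
  obtain ⟨z, hz, hzu⟩ := exists_lt_of_csInf_lt hNne (show sInf N < u from htu)
  have htz : t ≤ z := csInf_le hNbdd hz
  rcases eq_or_lt_of_le htz with h | h
  · exact hz.2 (h ▸ hpt)
  · exact hz.2 (hu ⟨h, hzu⟩)

/-- A function whose right derivative is nonpositive wherever it exceeds `c` does not exceed `c`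
if it does not do so initially. -/
theorem le_of_deriv_right_nonpos_above {f f' : ℝ → ℝ} {a b c : ℝ}
    (hf : ContinuousOn f (Icc a b)) (hf' : ∀ t ∈ Ico a b, HasDerivWithinAt f (f' t) (Ici t) t)
    (ha : f a ≤ c) (hle : ∀ t ∈ Ico a b, c < f t → f' t ≤ 0) : ∀ t ∈ Icc a b, f t ≤ c := by
  intro t ht
  -- The comparison line starts above `c` and rises with slope `e`. At a first contact `f` exceeds
  -- `c`, so its right derivative is at most `0 < e`, which gives the strict inequality that the
  -- boundary lemma needs. Then `e` tends to zero.
  have key : ∀ e > 0, f t ≤ c + e + e * (t - a) := by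
    intro e he
    refine image_le_of_deriv_right_lt_deriv_boundary (B := fun t => c + e + e * (t - a))
      (B' := fun _ => e) hf hf' (by simp; linarith) (fun x => ?_) (fun x hx hfx => ?_) ht
    · simpa using (((hasDerivAt_id x).sub_const a).const_mul e).const_add (c + e)
    · have : 0 ≤ e * (x - a) := mul_nonneg he.le (by linarith [hx.1])
      exact (hle x hx (by rw [hfx]; linarith)).trans_lt he
  have hpos : 0 < 1 + (t - a) := by linarith [ht.1]
  refine le_of_forall_pos_le_add fun e he => ?_
  have := key (e / (1 + (t - a))) (div_pos he hpos)
  have h2 : e / (1 + (t - a)) * (1 + (t - a)) = e := div_mul_cancel₀ _ hpos.ne'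
  linarith

/-- A function whose right derivative is at most `-q ≤ 0` wherever it exceeds `c` decreases at
rate `q` until it reaches `c`, and stays there. -/
theorem le_max_of_deriv_right_le_neg_above {f f' : ℝ → ℝ} {a b c q : ℝ} (hq : 0 ≤ q)
    (hf : ContinuousOn f (Icc a b)) (hf' : ∀ t ∈ Ico a b, HasDerivWithinAt f (f' t) (Ici t) t)
    (hle : ∀ t ∈ Ico a b, c < f t → f' t ≤ -q) :
    ∀ t ∈ Icc a b, f t ≤ max c (f a - q * (t - a)) := by
  intro t ht
  by_cases h : ∃ τ ∈ Icc a t, f τ ≤ c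
  · obtain ⟨τ, hτ, hfτ⟩ := h
    refine le_max_of_le_left (le_of_deriv_right_nonpos_above (a := τ) (b := b) (f' := f')
      (hf.mono (Icc_subset_Icc_left hτ.1)) (fun u hu => hf' u ⟨hτ.1.trans hu.1, hu.2⟩) hfτ
      (fun u hu hcu => (hle u ⟨hτ.1.trans hu.1, hu.2⟩ hcu).trans (by linarith)) t ⟨hτ.2, ht.2⟩)
  · push Not at h
    refine le_max_of_le_right ?_
    refine image_le_of_deriv_right_le_deriv_boundary (b := t) (f' := f')
      (B := fun t => f a - q * (t - a)) (B' := fun _ => -q)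
      (hf.mono (Icc_subset_Icc_right ht.2)) (fun x hx => hf' x ⟨hx.1, hx.2.trans_le ht.2⟩)
      (by simp) (by fun_prop) (fun x _ => ?_)
      (fun x hx => hle x ⟨hx.1, hx.2.trans_le ht.2⟩ (h x ⟨hx.1, hx.2.le⟩)) ⟨ht.1, le_rfl⟩
    simpa using ((((hasDerivAt_id x).sub_const a).const_mul q).const_sub (f a)).hasDerivWithinAt

/-- Exponential decay from `V' ≤ -β V + C`. -/
theorem le_exp_mul_add_of_deriv_right_le {V V' : ℝ → ℝ} {a b β C : ℝ} (hβ : 0 < β)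
    (hV : ContinuousOn V (Icc a b)) (hV' : ∀ t ∈ Ico a b, HasDerivWithinAt V (V' t) (Ici t) t)
    (hle : ∀ t ∈ Ico a b, V' t ≤ -β * V t + C) (ha : 0 ≤ C) :
    ∀ t ∈ Icc a b, V t ≤ Real.exp (-β * (t - a)) * V a + C / β := by
  intro t ht
  have hE : ∀ t, HasDerivAt (fun t => Real.exp (β * (t - a))) (Real.exp (β * (t - a)) * β) t :=
    fun t => by simpa using (((hasDerivAt_id t).sub_const a).const_mul β).exp
  -- With the integrating factor, `exp (β (t - a)) (V - C / β)` is nonincreasing.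
  have hmain := le_of_deriv_right_nonpos_above (c := V a - C / β)
    (f := fun t => Real.exp (β * (t - a)) * (V t - C / β))
    (f' := fun t => Real.exp (β * (t - a)) * β * (V t - C / β) + Real.exp (β * (t - a)) * V' t)
    (a := a) (b := b)
    ((by fun_prop : Continuous fun t => Real.exp (β * (t - a))).continuousOn.mul
      (hV.sub continuousOn_const))
    (fun t ht => ((hE t).hasDerivWithinAt.mul ((hV' t ht).sub_const _))) (by simp)
    (fun t ht _ => by
      have h1 := hle t ht
      have h2 : Real.exp (β * (t - a)) * β * (V t - C / β) + Real.exp (β * (t - a)) * V' t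
        = Real.exp (β * (t - a)) * (β * V t - C + V' t) := by field_simp
      rw [h2]
      exact mul_nonpos_of_nonneg_of_nonpos (Real.exp_pos _).le (by linarith)) t ht
  have hexp : Real.exp (-β * (t - a)) * Real.exp (β * (t - a)) = 1 := by
    rw [← Real.exp_add]; simp
  have h3 := mul_le_mul_of_nonneg_left hmain (Real.exp_pos (-β * (t - a))).le
  rw [← mul_assoc, hexp, one_mul] at h3
  have h4 : 0 ≤ Real.exp (-β * (t - a)) * (C / β) := by positivity
  nlinarith

/-! ### Positive definite maps -/

theorem IsPosDefMap.inner_nonneg {d : ℕ} {A : Lin d d} (hA : IsPosDefMap A) (v : Vec d) :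
    0 ≤ ⟪A v, v⟫ := by
  rcases eq_or_ne v 0 with rfl | hv
  · simp
  · exact (hA.2 v hv).le

theorem IsPosDefMap.exists_coercive {d : ℕ} {A : Lin d d} (hA : IsPosDefMap A) :
    ∃ c > 0, ∀ v : Vec d, c * ‖v‖ ^ 2 ≤ ⟪A v, v⟫ := by
  rcases (Metric.sphere (0 : Vec d) 1).eq_empty_or_nonempty with h | h
  · refine ⟨1, one_pos, fun v => ?_⟩
    rcases eq_or_ne v 0 with rfl | hv
    · simp
    · exact absurd (show ‖v‖⁻¹ • v ∈ Metric.sphere (0 : Vec d) 1 by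
        simp [norm_smul, inv_mul_cancel₀ (norm_ne_zero_iff.2 hv)]) (h ▸ notMem_empty _)
  · obtain ⟨u, hu, hmin⟩ := (isCompact_sphere (0 : Vec d) 1).exists_isMinOn h
      (f := fun v => ⟪A v, v⟫) (by fun_prop)
    have hu0 : u ≠ 0 := by rintro rfl; simp at hu
    refine ⟨⟪A u, u⟫, hA.2 u hu0, fun v => ?_⟩
    rcases eq_or_ne v 0 with rfl | hv
    · simp
    · have hv' := norm_ne_zero_iff.2 hv
      have := hmin (show ‖v‖⁻¹ • v ∈ Metric.sphere (0 : Vec d) 1 by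
        simp [norm_smul, inv_mul_cancel₀ hv'])
      simp only [map_smul, inner_smul_left, inner_smul_right, mem_ofPred_eq] at this
      simp only [map_inv₀, conj_trivial] at this
      calc ⟪A u, u⟫ * ‖v‖ ^ 2 ≤ (‖v‖⁻¹ * (‖v‖⁻¹ * ⟪A v, v⟫)) * ‖v‖ ^ 2 := by gcongr
        _ = ⟪A v, v⟫ := by field_simp

theorem IsPosDefMap.isUnit {d : ℕ} {A : Lin d d} (hA : IsPosDefMap A) : IsUnit A := by
  obtain ⟨c, hc, h⟩ := hA.exists_coercive
  refine ContinuousLinearMap.isUnit_of_forall_le_norm_inner_map A (c := ⟨c, hc.le⟩) hc fun v => ?_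
  have := (h v).trans (le_abs_self _)
  change ‖v‖ ^ 2 * c ≤ |⟪A v, v⟫|
  rwa [mul_comm]

theorem IsPosDefMap.apply_inverse {d : ℕ} {A : Lin d d} (hA : IsPosDefMap A) (v : Vec d) :
    A (Ring.inverse A v) = v := by
  have := congrArg (fun T : Lin d d => T v) (Ring.mul_inverse_cancel A hA.isUnit)
  simpa using this

theorem IsPosDefMap.inverse_apply {d : ℕ} {A : Lin d d} (hA : IsPosDefMap A) (v : Vec d) :
    Ring.inverse A (A v) = v := by
  have := congrArg (fun T : Lin d d => T v) (Ring.inverse_mul_cancel A hA.isUnit)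
  simpa using this

theorem IsPosDefMap.inner_comm {d : ℕ} {A : Lin d d} (hA : IsPosDefMap A) (v w : Vec d) :
    ⟪A v, w⟫ = ⟪v, A w⟫ := hA.1.isSymmetric v w

theorem IsPosDefMap.inner_inverse_comm {d : ℕ} {A : Lin d d} (hA : IsPosDefMap A) (v w : Vec d) :
    ⟪Ring.inverse A v, w⟫ = ⟪v, Ring.inverse A w⟫ := by
  nth_rw 1 [← hA.apply_inverse w]
  rw [← hA.inner_comm, hA.apply_inverse]

theorem IsPosDefMap.inner_inverse_nonneg {d : ℕ} {A : Lin d d} (hA : IsPosDefMap A) (v : Vec d) :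
    0 ≤ ⟪Ring.inverse A v, v⟫ := by
  have := hA.inner_nonneg (Ring.inverse A v)
  rwa [hA.apply_inverse, real_inner_comm] at this

/-- Cauchy-Schwarz for a symmetric nonnegative form. -/
theorem norm_apply_sq_le_of_nonneg {d : ℕ} {A : Lin d d} (hA : IsSelfAdjoint A)
    (hnn : ∀ v, 0 ≤ ⟪A v, v⟫) {G : ℝ} (hG : ‖A‖ ≤ G) (v : Vec d) :
    ‖A v‖ ^ 2 ≤ G * ⟪A v, v⟫ := by
  have hsymm : ∀ x y, ⟪A x, y⟫ = ⟪x, A y⟫ := hA.isSymmetric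
  have h1 : ⟪A (A v), A v⟫ ≤ G * ‖A v‖ ^ 2 := by
    calc ⟪A (A v), A v⟫ ≤ ‖A (A v)‖ * ‖A v‖ := real_inner_le_norm _ _
      _ ≤ (‖A‖ * ‖A v‖) * ‖A v‖ := by gcongr; exact A.le_opNorm _
      _ ≤ (G * ‖A v‖) * ‖A v‖ := by gcongr
      _ = _ := by ring
  have hG0 : 0 ≤ G := (norm_nonneg _).trans hG
  -- Expanding the form at `A v - G v` gives `2 G ‖A v‖² ≤ ⟪A (A v), A v⟫ + G² ⟪A v, v⟫`, whose
  -- first term on the right is at most `G ‖A v‖²`. Dividing by `G` needs `G ≠ 0`, hence the case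
  -- split below.
  have h2 := hnn (A v - G • v)
  simp only [map_sub, map_smul, inner_sub_left, inner_sub_right, inner_smul_left,
    inner_smul_right, conj_trivial] at h2
  have h3 : ⟪A (A v), v⟫ = ‖A v‖ ^ 2 := by rw [hsymm, real_inner_self_eq_norm_sq]
  have h4 : ⟪A v, A v⟫ = ‖A v‖ ^ 2 := real_inner_self_eq_norm_sq _
  rw [h3, h4] at h2
  rcases hG0.eq_or_lt with h0 | h0
  · have : ‖A v‖ ≤ 0 := by simpa [← h0] using (A.le_opNorm v).trans (mul_le_mul_of_nonneg_right hG (norm_nonneg v))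
    have h5 : ‖A v‖ = 0 := le_antisymm this (norm_nonneg _)
    simp [h5, ← h0]
  · have : G * ‖A v‖ ^ 2 ≤ G * (G * ⟪A v, v⟫) := by nlinarith
    exact le_of_mul_le_mul_left this h0

/-! ### The Riccati equation of the least squares gain -/

/-- Solutions of the Riccati equation with a symmetric initial value are symmetric. -/
theorem isSelfAdjoint_of_riccati {E : Type*} [NormedAddCommGroup E] [InnerProductSpace ℝ E]
    [CompleteSpace E] {Γ M : ℝ → E →L[ℝ] E} {a b β Mbar G : ℝ}
    (hΓ : ContinuousOn Γ (Icc a b))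
    (hΓ' : ∀ t ∈ Ico a b, HasDerivWithinAt Γ (β • Γ t - Γ t ∘L M t ∘L Γ t) (Ici t) t)
    (hM : ∀ t, IsSelfAdjoint (M t)) (hMb : ∀ t ∈ Ico a b, ‖M t‖ ≤ Mbar)
    (hG : ∀ t ∈ Icc a b, ‖Γ t‖ ≤ G)
    (ha : IsSelfAdjoint (Γ a)) : ∀ t ∈ Icc a b, IsSelfAdjoint (Γ t) := by
  intro t ht
  -- The skew part `D = Γ - Γ*` vanishes at `a` and satisfies `D' = β D - (D M Γ + Γ* M D)`, which
  -- is linear in `D`, so Grönwall's inequality keeps it zero.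
  have hz := eq_zero_of_abs_deriv_le_mul_abs_self_of_eq_zero_right
    (f := fun t => Γ t - star (Γ t)) (a := a) (b := b) (K := |β| + 2 * (Mbar * G))
    (f' := fun t => (β • Γ t - Γ t ∘L M t ∘L Γ t) - star (β • Γ t - Γ t ∘L M t ∘L Γ t))
    (hΓ.sub hΓ.star) (fun t ht => (hΓ' t ht).sub (hΓ' t ht).star)
    (sub_eq_zero.2 ha.star_eq.symm) (fun t ht => ?_) t ht
  · exact (sub_eq_zero.1 hz).symm
  · have hMt := hMb t ht
    have hGt := hG t (Ico_subset_Icc_self ht)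
    have hG0 : 0 ≤ G := (norm_nonneg _).trans hGt
    have hM0 : 0 ≤ Mbar := (norm_nonneg _).trans hMt
    have e : (β • Γ t - Γ t ∘L M t ∘L Γ t) - star (β • Γ t - Γ t ∘L M t ∘L Γ t)
        = β • (Γ t - star (Γ t)) - ((Γ t - star (Γ t)) * M t * Γ t
          + star (Γ t) * M t * (Γ t - star (Γ t))) := by
      change (β • Γ t - Γ t * (M t * Γ t)) - star (β • Γ t - Γ t * (M t * Γ t)) = _
      simp only [star_sub, star_smul, star_mul, (hM t).star_eq, star_trivial, smul_sub]
      noncomm_ring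
    rw [e]
    set D := Γ t - star (Γ t)
    have hst : ‖star (Γ t)‖ ≤ G := (norm_star (Γ t)).trans_le hGt
    calc _ ≤ ‖β • D‖ + (‖D * M t * Γ t‖ + ‖star (Γ t) * M t * D‖) :=
          (norm_sub_le _ _).trans (add_le_add_right (norm_add_le _ _) _)
      _ ≤ |β| * ‖D‖ + (‖D‖ * Mbar * G + G * Mbar * ‖D‖) := by
          gcongr
          · rw [norm_smul, Real.norm_eq_abs]
          · refine (norm_mul_le _ _).trans ?_
            gcongr
            refine (norm_mul_le _ _).trans ?_
            gcongr
          · refine (norm_mul_le _ _).trans ?_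
            gcongr
            refine (norm_mul_le _ _).trans ?_
            gcongr
      _ = _ := by ring

/-- A solution of the Riccati equation whose form has been nonnegative is positive definite. -/
theorem isPosDefMap_of_riccati_of_nonneg {d : ℕ} {Γ M : ℝ → Lin d d} {a b β Mbar : ℝ}
    (hab : a ≤ b)
    (hΓ : ContinuousOn Γ (Icc a b))
    (hΓ' : ∀ t ∈ Ico a b, HasDerivWithinAt Γ (β • Γ t - Γ t ∘L M t ∘L Γ t) (Ici t) t)
    (hM : ∀ t, IsSelfAdjoint (M t)) (hMb : ∀ t ∈ Ico a b, ‖M t‖ ≤ Mbar)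
    (hnn : ∀ t ∈ Ico a b, ∀ v, 0 ≤ ⟪Γ t v, v⟫)
    (ha : IsPosDefMap (Γ a)) : IsPosDefMap (Γ b) := by
  obtain ⟨G, hG⟩ := isCompact_Icc.exists_bound_of_continuousOn hΓ
  have hG0 : 0 ≤ G := (norm_nonneg _).trans (hG a (left_mem_Icc.2 hab))
  have hsa := isSelfAdjoint_of_riccati hΓ hΓ' hM hMb hG ha.1
  refine ⟨hsa b (right_mem_Icc.2 hab), fun v hv => ?_⟩
  -- As `‖Γ v‖² ≤ G ⟪Γ v, v⟫`, the quadratic Riccati term is at most `Mbar G ⟪Γ v, v⟫`. With this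
  -- rate `exp (κ t) ⟪Γ v, v⟫` is nondecreasing and stays positive.
  set κ := Mbar * G - β with hκ
  have hE : ∀ t, HasDerivAt (fun t => Real.exp (κ * t)) (Real.exp (κ * t) * κ) t :=
    fun t => by simpa using ((hasDerivAt_id t).const_mul κ).exp
  have hq : ∀ t ∈ Ico a b, HasDerivWithinAt (fun t => ⟪Γ t v, v⟫)
      ⟪(β • Γ t - Γ t ∘L M t ∘L Γ t) v, v⟫ (Ici t) t := fun t ht => by
    simpa using ((hΓ' t ht).clm_apply (hasDerivWithinAt_const t _ v)).inner ℝ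
      (hasDerivWithinAt_const t _ v)
  have hmain := le_of_deriv_right_nonpos_above (c := -(Real.exp (κ * a) * ⟪Γ a v, v⟫))
    (f := fun t => -(Real.exp (κ * t) * ⟪Γ t v, v⟫)) (a := a) (b := b)
    ((by fun_prop : Continuous fun t => Real.exp (κ * t)).continuousOn.mul
      ((hΓ.clm_apply continuousOn_const).inner continuousOn_const)).neg
    (fun t ht => ((hE t).hasDerivWithinAt.mul (hq t ht)).neg) le_rfl
    (fun t ht _ => ?_) b (right_mem_Icc.2 hab)
  · have h1 : 0 < Real.exp (κ * a) * ⟪Γ a v, v⟫ := mul_pos (Real.exp_pos _) (ha.2 v hv)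
    have h2 : 0 < Real.exp (κ * b) * ⟪Γ b v, v⟫ := by linarith
    exact (pos_iff_pos_of_mul_pos h2).1 (Real.exp_pos _)
  · have hsat := hsa t (Ico_subset_Icc_self ht)
    have hcs := norm_apply_sq_le_of_nonneg hsat (hnn t ht) (hG t (Ico_subset_Icc_self ht)) v
    have h1 : ⟪(Γ t ∘L M t ∘L Γ t) v, v⟫ ≤ Mbar * (G * ⟪Γ t v, v⟫) := by
      calc ⟪(Γ t ∘L M t ∘L Γ t) v, v⟫ = ⟪M t (Γ t v), Γ t v⟫ := hsat.isSymmetric _ _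
        _ ≤ ‖M t (Γ t v)‖ * ‖Γ t v‖ := real_inner_le_norm _ _
        _ ≤ (Mbar * ‖Γ t v‖) * ‖Γ t v‖ := by
            gcongr
            exact ((M t).le_opNorm _).trans (by gcongr; exact hMb t ht)
        _ = Mbar * ‖Γ t v‖ ^ 2 := by ring
        _ ≤ _ := by gcongr; exact (norm_nonneg _).trans (hMb t ht)
    have h2 : ⟪(β • Γ t - Γ t ∘L M t ∘L Γ t) v, v⟫
        = β * ⟪Γ t v, v⟫ - ⟪(Γ t ∘L M t ∘L Γ t) v, v⟫ := by
      simp [inner_sub_left, inner_smul_left]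
    rw [h2]
    have h3 : 0 ≤ Real.exp (κ * t) *
      (κ * ⟪Γ t v, v⟫ + (β * ⟪Γ t v, v⟫ - ⟪(Γ t ∘L M t ∘L Γ t) v, v⟫)) := by
      refine mul_nonneg (Real.exp_pos _).le ?_
      rw [hκ]; nlinarith
    nlinarith

/-- A solution of the Riccati equation that starts symmetric positive definite remains so. -/
theorem isPosDefMap_of_riccati {d : ℕ} {Γ M : ℝ → Lin d d} {a b β Mbar : ℝ}
    (hΓ : ContinuousOn Γ (Icc a b))
    (hΓ' : ∀ t ∈ Ico a b, HasDerivWithinAt Γ (β • Γ t - Γ t ∘L M t ∘L Γ t) (Ici t) t)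
    (hM : ∀ t, IsSelfAdjoint (M t))
    (hMb : ∀ t ∈ Ico a b, (∀ v, 0 ≤ ⟪Γ t v, v⟫) → ‖M t‖ ≤ Mbar)
    (ha : IsPosDefMap (Γ a)) : ∀ t ∈ Icc a b, IsPosDefMap (Γ t) := by
  have hstep : ∀ t ∈ Icc a b, (∀ τ ∈ Ico a t, ∀ v, 0 ≤ ⟪Γ τ v, v⟫) → IsPosDefMap (Γ t) := by
    intro t ht hnn
    have hsub : Ico a t ⊆ Ico a b := Ico_subset_Ico_right ht.2
    exact isPosDefMap_of_riccati_of_nonneg ht.1 (hΓ.mono (Icc_subset_Icc_right ht.2))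
      (fun τ hτ => hΓ' τ (hsub hτ)) hM (fun τ hτ => hMb τ (hsub hτ) (hnn τ hτ)) hnn ha
  -- Real induction is needed because the bound on `M` is available only while the form of `Γ` is
  -- nonnegative. Nonnegativity before `t` yields definiteness at `t`, and coercivity carries
  -- nonnegativity past `t` by continuity.
  have hnn : ∀ t ∈ Icc a b, ∀ v, 0 ≤ ⟪Γ t v, v⟫ := by
    refine forall_mem_Icc_of_real_induction
      (fun t ht h => (hstep t ht h).inner_nonneg) (fun t ht h => ?_)
    obtain ⟨c, hc, hcoer⟩ :=
      (hstep t (Ico_subset_Icc_self ht) fun τ hτ => h τ (Ico_subset_Icc_self hτ)).exists_coercive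
    have hcont : Tendsto Γ (𝓝[>] t) (𝓝 (Γ t)) :=
      ((hΓ' t ht).continuousWithinAt.mono Ioi_subset_Ici_self)
    filter_upwards [hcont.eventually (Metric.ball_mem_nhds (Γ t) hc)] with τ hτ v
    have h1 : |⟪(Γ τ - Γ t) v, v⟫| ≤ c * ‖v‖ ^ 2 := by
      calc _ ≤ ‖(Γ τ - Γ t) v‖ * ‖v‖ := abs_real_inner_le_norm _ _
        _ ≤ (‖Γ τ - Γ t‖ * ‖v‖) * ‖v‖ := by gcongr; exact ContinuousLinearMap.le_opNorm _ _
        _ ≤ (c * ‖v‖) * ‖v‖ := by gcongr; exact (mem_ball_iff_norm.1 hτ).le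
        _ = _ := by ring
    have h2 : ⟪(Γ τ - Γ t) v, v⟫ = ⟪Γ τ v, v⟫ - ⟪Γ t v, v⟫ := by simp [inner_sub_left]
    have := neg_le_of_abs_le h1
    linarith [hcoer v]
  exact fun t ht => hstep t ht fun τ hτ => hnn τ ⟨hτ.1, hτ.2.le.trans ht.2⟩

/-- The inverse of a solution of the Riccati equation solves a linear equation. -/
theorem hasDerivWithinAt_inverse_of_riccati {A : Type*} [NormedRing A] [NormedAlgebra ℝ A]
    [HasSummableGeomSeries A] {Γ : ℝ → A} {M : A} {β t : ℝ} (hΓ : IsUnit (Γ t))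
    (hΓ' : HasDerivWithinAt Γ (β • Γ t - Γ t * (M * Γ t)) (Ici t) t) :
    HasDerivWithinAt (fun τ => Ring.inverse (Γ τ)) (-(β • Ring.inverse (Γ t)) + M) (Ici t) t := by
  obtain ⟨u, hu⟩ := hΓ
  have h1 := hasFDerivAt_ringInverse (𝕜 := ℝ) u
  rw [hu] at h1
  refine (h1.comp_hasDerivWithinAt t hΓ').congr_deriv ?_
  change -(↑u⁻¹ * (β • Γ t - Γ t * (M * Γ t)) * ↑u⁻¹) = _
  simp only [← hu, Ring.inverse_unit]
  simp only [mul_sub, sub_mul, mul_smul_comm, smul_mul_assoc, Units.inv_mul, one_mul, mul_assoc,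
    Units.mul_inv, mul_one, Units.inv_mul_cancel_left]
  abel

theorem continuousOn_inverse {d : ℕ} {Γ : ℝ → Lin d d} {s : Set ℝ}
    (hΓ : ContinuousOn Γ s) (hpd : ∀ t ∈ s, IsPosDefMap (Γ t)) :
    ContinuousOn (fun τ => Ring.inverse (Γ τ)) s := by
  intro t ht
  obtain ⟨u, hu⟩ := (hpd t ht).isUnit
  have h1 := (hasFDerivAt_ringInverse (𝕜 := ℝ) u).continuousAt
  rw [hu] at h1
  exact h1.comp_continuousWithinAt (hΓ t ht)

/-- Growth of the information matrix `Γ⁻¹` over a window. -/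
theorem le_inner_inverse_of_riccati {d : ℕ} {Γ M : ℝ → Lin d d} {a b β : ℝ} (hβ : 0 < β)
    (hab : a ≤ b)
    (hΓ : ContinuousOn Γ (Icc a b)) (hpd : ∀ t ∈ Icc a b, IsPosDefMap (Γ t))
    (hΓ' : ∀ t ∈ Ico a b, HasDerivWithinAt Γ (β • Γ t - Γ t ∘L M t ∘L Γ t) (Ici t) t)
    {v : Vec d} {q : ℝ → ℝ} (hq : IntegrableOn q (Icc a b))
    (hqnn : ∀ t ∈ Ico a b, 0 ≤ q t) (hqM : ∀ t ∈ Ico a b, q t ≤ ⟪M t v, v⟫) :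
    Real.exp (-β * (b - a)) * ∫ τ in a..b, q τ ≤ ⟪Ring.inverse (Γ b) v, v⟫ := by
  have hE : ∀ t, HasDerivAt (fun t => Real.exp (β * (t - a))) (Real.exp (β * (t - a)) * β) t :=
    fun t => by simpa using (((hasDerivAt_id t).sub_const a).const_mul β).exp
  have hinv := continuousOn_inverse hΓ hpd
  have hd : ∀ t ∈ Ico a b, HasDerivWithinAt (fun t => ⟪Ring.inverse (Γ t) v, v⟫)
      ⟪(-(β • Ring.inverse (Γ t)) + M t) v, v⟫ (Ici t) t := fun t ht => by
    simpa using ((hasDerivWithinAt_inverse_of_riccati (hpd t (Ico_subset_Icc_self ht)).isUnit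
      (hΓ' t ht)).clm_apply (hasDerivWithinAt_const t _ v)).inner ℝ
      (hasDerivWithinAt_const t _ v)
  -- The derivative of `exp (β (t - a)) ⟪Γ⁻¹ v, v⟫` is `exp (β (t - a)) ⟪M v, v⟫ ≥ q t`. Only the
  -- minorant `q` has to be integrable, not `M`.
  have hmain := intervalIntegral.integral_le_sub_of_hasDeriv_right_of_le hab
    (g := fun t => Real.exp (β * (t - a)) * ⟪Ring.inverse (Γ t) v, v⟫) (φ := q)
    ((by fun_prop : Continuous fun t => Real.exp (β * (t - a))).continuousOn.mul
      ((hinv.clm_apply continuousOn_const).inner continuousOn_const))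
    (fun t ht => ((hE t).hasDerivWithinAt.mul
      ((hd t (Ioo_subset_Ico_self ht)).mono Ioi_subset_Ici_self))) hq (fun t ht => ?_)
  · have h0 := (hpd a (left_mem_Icc.2 hab)).inner_inverse_nonneg v
    simp only [sub_self, mul_zero, Real.exp_zero, one_mul] at hmain
    have h1 : ∫ τ in a..b, q τ ≤ Real.exp (β * (b - a)) * ⟪Ring.inverse (Γ b) v, v⟫ := by
      linarith
    calc _ ≤ Real.exp (-β * (b - a)) * (Real.exp (β * (b - a)) * ⟪Ring.inverse (Γ b) v, v⟫) := by
          gcongr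
      _ = _ := by rw [← mul_assoc, ← Real.exp_add]; simp
  · have ht' := Ioo_subset_Ico_self ht
    have h2 : ⟪(-(β • Ring.inverse (Γ t)) + M t) v, v⟫
        = -(β * ⟪Ring.inverse (Γ t) v, v⟫) + ⟪M t v, v⟫ := by
      simp [inner_add_left, inner_smul_left]
    have h1 : 1 ≤ Real.exp (β * (t - a)) :=
      Real.one_le_exp (mul_nonneg hβ.le (by linarith [ht.1]))
    rw [h2]
    have := hqnn t ht'
    have := hqM t ht'
    nlinarith

/-! ### Gradients, softplus and the projection operator -/

theorem hasGradientAt_inner_comp {d e : ℕ} {F : Vec d → Vec e} {x : Vec d} (w : Vec e)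
    (hF : DifferentiableAt ℝ F x) :
    HasGradientAt (fun y => ⟪w, F y⟫) (ContinuousLinearMap.adjoint (fderiv ℝ F x) w) x := by
  rw [hasGradientAt_iff_hasFDerivAt]
  convert! (hasFDerivAt_const w x).inner ℝ hF.hasFDerivAt using 1
  ext v
  simp [ContinuousLinearMap.adjoint_inner_left]

theorem continuousOn_gradient {d : ℕ} {h : Vec d → ℝ} {U : Set (Vec d)} (hU : IsOpen U)
    (hh : ContDiffOn ℝ 1 h U) : ContinuousOn (gradient h) U :=
  (InnerProductSpace.toDual ℝ (Vec d)).symm.continuous.comp_continuousOn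
    (hh.continuousOn_fderiv_of_isOpen hU le_rfl)

theorem softplus_nonneg {k : ℝ} (hk : 0 < k) (z : ℝ) : 0 ≤ softplus k z :=
  mul_nonneg hk.le (Real.log_nonneg (by linarith [Real.exp_pos (z / k)]))

theorem continuous_softplus (k : ℝ) : Continuous (softplus k) := by
  refine continuous_const.mul (Continuous.log (by fun_prop) fun z => ?_)
  positivity

/-- The projected vector field does not point out of the ball of radius `r`. -/
theorem inner_proj_nonpos {d : ℕ} {r tol : ℝ} (hr : 0 < r) (htol : 0 < tol) {w : Vec d}
    (hw : r ^ 2 < ‖w‖ ^ 2) (y : Vec d) : ⟪w, proj r tol w y⟫ ≤ 0 := by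
  have hf : 1 < projFun r tol w := by
    unfold projFun
    rw [one_lt_div (by positivity)]
    nlinarith [mul_pos htol (sub_pos.2 hw)]
  have hw0 : ‖w‖ ^ 2 ≠ 0 := (lt_trans (by positivity) hw).ne'
  unfold proj
  -- In the active branch the radial component of `y` is multiplied by `1 - projFun r tol w`, which
  -- is negative outside the ball.
  split_ifs with h
  · rw [inner_sub_right, inner_smul_right, real_inner_self_eq_norm_sq, mul_assoc,
      div_mul_cancel₀ _ hw0]
    nlinarith [h.2]
  · exact not_lt.1 fun h' => h ⟨by linarith, h'⟩

namespace ACIL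

variable {n m p b N : ℕ} {P : ACIL n m p b N}

/-! ### First consequences of the standing assumptions -/

theorem Standing.Dφ_continuousOn (hP : P.Standing) : ContinuousOn P.Dφ P.D := fun x hx =>
  ((hP.φ_contDiff x hx).fderiv_right (m := 0) le_rfl).continuousAt.continuousWithinAt

theorem Standing.φ_differentiableAt (hP : P.Standing) {x : Vec n} (hx : x ∈ P.D) :
    DifferentiableAt ℝ P.φ x := (hP.φ_contDiff x hx).differentiableAt one_ne_zero

theorem Standing.interior_subset_D (hP : P.Standing) : interior P.C ⊆ P.D :=
  interior_subset.trans hP.C_subset_D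

theorem Standing.gradB_continuousOn (hP : P.Standing) :
    ContinuousOn P.gradB (interior P.C) := continuousOn_gradient isOpen_interior hP.B_contDiff

theorem Standing.varsig_pos (hP : P.Standing) : 0 < P.varsig := by
  have := hP.Rgbar_pos
  have := hP.lg_pos
  have := Real.log_pos one_lt_two
  unfold varsig
  positivity

theorem Standing.le_lamHat (hP : P.Standing) (x : Vec n) (wa : Vec b) (ϑ : Vec p) :
    P.k * P.varsig ≤ P.lamHat x wa ϑ :=
  le_add_of_nonneg_left (softplus_nonneg hP.k_pos _)

theorem Standing.le_Rbf (hP : P.Standing) {x : Vec n} (hx : x ∈ P.C) :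
    P.lg * ‖P.gradB x‖ ^ 2 ≤ P.Rbf x := by
  unfold Rbf
  rw [real_inner_comm]
  rcases eq_or_ne (P.gradB x) 0 with h | h
  · simp [h]
  · exact (hP.Rg_lower x hx _ h).le

theorem Standing.Rbf_nonneg (hP : P.Standing) {x : Vec n} (hx : x ∈ P.C) : 0 ≤ P.Rbf x :=
  (mul_nonneg hP.lg_pos.le (sq_nonneg _)).trans (hP.le_Rbf hx)

theorem g_uHat (P : ACIL n m p b N) (x : Vec n) (wa : Vec b) (ϑ : Vec p) :
    P.g x (P.uHat x wa ϑ)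
      = -(P.Rg x (P.DφT x wa)) - P.lamHat x wa ϑ • P.Rg x (P.gradB x) := by
  simp only [uHat, Rg, map_neg, map_add, map_smul, ContinuousLinearMap.comp_apply]
  abel

/-! ### The Bellman error is affine in the critic weights -/

/-- The closed-loop drift used in the Bellman error. -/
noncomputable def vel (P : ACIL n m p b N) (x : Vec n) (wa : Vec b) (ϑ : Vec p) : Vec n :=
  P.f x ϑ + P.g x (P.uHat x wa ϑ)

/-- The part of the Bellman error that does not depend on the critic weights. -/
noncomputable def bellmanOffset (P : ACIL n m p b N) (x : Vec n) (wa : Vec b) (ϑ : Vec p) : ℝ :=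
  P.r x (P.uHat x wa ϑ) + P.lamHat x wa ϑ * ⟪P.gradB x, P.vel x wa ϑ⟫

theorem Standing.bellman_eq (hP : P.Standing) {x : Vec n} (hx : x ∈ P.D) (wc wa : Vec b)
    (ϑ : Vec p) :
    P.bellman x wc wa ϑ = ⟪wc, P.Dφ x (P.vel x wa ϑ)⟫ + P.bellmanOffset x wa ϑ := by
  have h : gradient (P.LHat wc) x = P.DφT x wc :=
    (hasGradientAt_inner_comp wc (hP.φ_differentiableAt hx)).gradient
  unfold bellman bellmanOffset
  rw [h, inner_add_left, inner_smul_left, DφT, ContinuousLinearMap.adjoint_inner_left]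
  simp only [conj_trivial, vel]
  ring

theorem Standing.omega_eq (hP : P.Standing) {x : Vec n} (hx : x ∈ P.D) (wc wa : Vec b)
    (ϑ : Vec p) : P.omega x wc wa ϑ = P.Dφ x (P.vel x wa ϑ) := by
  have h : (fun w => P.bellman x w wa ϑ)
      = fun w => ⟪P.Dφ x (P.vel x wa ϑ), w⟫ + P.bellmanOffset x wa ϑ := by
    funext w
    rw [hP.bellman_eq hx, real_inner_comm]
  unfold omega
  rw [h]
  refine HasGradientAt.gradient ?_
  rw [hasGradientAt_iff_hasFDerivAt]
  refine HasFDerivAt.add_const _ ?_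
  exact (InnerProductSpace.toDual ℝ (Vec b) _).hasFDerivAt

/-! ### Boundedness on compact subsets of the interior of the constraint set -/

/-- The state cost is subtracted because `Q` is not assumed continuous. Its boundedness on compact
sets is obtained from the HJB equation instead. -/
theorem Standing.continuousOn_vel_and_offset (hP : P.Standing) :
    ContinuousOn (fun z : Vec n × Vec b × Vec p => P.Dφ z.1 (P.vel z.1 z.2.1 z.2.2))
        (interior P.C ×ˢ univ) ∧
      ContinuousOn (fun z : Vec n × Vec b × Vec p =>
        P.bellmanOffset z.1 z.2.1 z.2.2 - P.Q z.1) (interior P.C ×ˢ univ) := by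
  set S : Set (Vec n × Vec b × Vec p) := interior P.C ×ˢ univ
  have hfst : MapsTo (fun z : Vec n × Vec b × Vec p => z.1) S (interior P.C) := fun z hz => hz.1
  have hB : ContinuousOn (fun z : Vec n × Vec b × Vec p => P.gradB z.1) S :=
    hP.gradB_continuousOn.comp continuousOn_fst hfst
  have hD : ContinuousOn (fun z : Vec n × Vec b × Vec p => P.Dφ z.1) S :=
    (hP.Dφ_continuousOn.mono hP.interior_subset_D).comp continuousOn_fst hfst
  have hDT : ContinuousOn (fun z : Vec n × Vec b × Vec p => P.DφT z.1) S :=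
    ContinuousLinearMap.adjoint.continuous.comp_continuousOn hD
  have hg : Continuous fun z : Vec n × Vec b × Vec p => P.g z.1 :=
    hP.continuous_g.comp continuous_fst
  have hgT : Continuous fun z : Vec n × Vec b × Vec p => ContinuousLinearMap.adjoint (P.g z.1) :=
    ContinuousLinearMap.adjoint.continuous.comp hg
  have hRg : Continuous fun z : Vec n × Vec b × Vec p => P.Rg z.1 :=
    hg.clm_comp (continuous_const.clm_comp hgT)
  have hf : Continuous fun z : Vec n × Vec b × Vec p => P.f z.1 z.2.2 :=
    (hP.continuous_Y.comp continuous_fst).clm_apply (by fun_prop)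
  have hwa : ContinuousOn (fun z : Vec n × Vec b × Vec p => P.DφT z.1 z.2.1) S :=
    hDT.clm_apply (by fun_prop)
  have hCs : ContinuousOn (fun z : Vec n × Vec b × Vec p => P.CsHat z.1 z.2.1 z.2.2) S :=
    (hB.inner hf.continuousOn).sub (hB.inner (hRg.continuousOn.clm_apply hwa))
  have hRbf : ContinuousOn (fun z : Vec n × Vec b × Vec p => P.Rbf z.1) S :=
    hB.inner (hRg.continuousOn.clm_apply hB)
  have hlam : ContinuousOn (fun z : Vec n × Vec b × Vec p => P.lamHat z.1 z.2.1 z.2.2) S := by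
    refine ((continuous_softplus P.k).comp_continuousOn
      (hCs.div (hRbf.add continuousOn_const) fun z hz => ?_)).add continuousOn_const
    exact (add_pos_of_nonneg_of_pos (hP.Rbf_nonneg (interior_subset (hfst hz))) hP.ksb_pos).ne'
  have hu : ContinuousOn (fun z : Vec n × Vec b × Vec p => P.uHat z.1 z.2.1 z.2.2) S :=
    (P.R.inverse.continuous.comp_continuousOn
      (hgT.continuousOn.clm_apply (hwa.add (hlam.smul hB)))).neg
  have hvel : ContinuousOn (fun z : Vec n × Vec b × Vec p => P.vel z.1 z.2.1 z.2.2) S :=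
    hf.continuousOn.add (hg.continuousOn.clm_apply hu)
  refine ⟨hD.clm_apply hvel, ?_⟩
  refine ContinuousOn.congr (f := fun z : Vec n × Vec b × Vec p =>
    1 / 2 * ⟪P.uHat z.1 z.2.1 z.2.2, P.R (P.uHat z.1 z.2.1 z.2.2)⟫
      + P.lamHat z.1 z.2.1 z.2.2 * ⟪P.gradB z.1, P.vel z.1 z.2.1 z.2.2⟫)
    ((continuousOn_const.mul (hu.inner (P.R.continuous.comp_continuousOn hu))).add
      (hlam.mul (hB.inner hvel))) fun z _ => ?_
  simp only [bellmanOffset, r]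
  ring

/-- The Hamilton-Jacobi-Bellman equation bounds the state cost. -/
theorem Standing.exists_Q_le (hP : P.Standing) {L : Vec n → ℝ} (hL : P.SolvesHJB L)
    {K : Set (Vec n)} (hK : IsCompact K) (hKC : K ⊆ interior P.C) :
    ∃ q, ∀ x ∈ K, P.Q x ≤ q := by
  obtain ⟨cL, hcL⟩ := hK.exists_bound_of_continuousOn
    ((continuousOn_gradient isOpen_interior hL.contDiff).mono hKC)
  obtain ⟨cf, hcf⟩ := hK.exists_bound_of_continuousOn
    (f := fun x => P.f x P.θ) (hP.continuous_Y.clm_apply continuous_const).continuousOn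
  obtain ⟨cg, hcg⟩ := hK.exists_bound_of_continuousOn hP.continuous_g.continuousOn
  obtain ⟨r₀, hr₀, hR⟩ := hP.R_posDef.exists_coercive
  -- This bounds the covector `λ* ∇B + ∇L`. The minimum in the HJB equation is attained with value
  -- zero, which expresses `Q` through this covector, the dynamics and a minimizing `u`. The
  -- quadratic control cost absorbs the term linear in `u`.
  set cp := (cf + P.Rgbar * cL) / P.lg + cL with hcp
  refine ⟨cp * cf + (cp * cg) ^ 2 / (2 * r₀), fun x hx => ?_⟩
  have hxC := interior_subset (hKC hx)
  have hcf0 : 0 ≤ cf := (norm_nonneg _).trans (hcf x hx)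
  have hcg0 : 0 ≤ cg := (norm_nonneg _).trans (hcg x hx)
  have hcL0 : 0 ≤ cL := (norm_nonneg _).trans (hcL x hx)
  have hlg := hP.lg_pos
  have hRb := hP.Rgbar_pos
  have hlam0 : 0 ≤ P.lamStar L x := by
    unfold lamStar
    split_ifs
    · exact le_max_right _ _
    · exact le_rfl
  have hlam : ‖P.lamStar L x • P.gradB x‖ ≤ (cf + P.Rgbar * cL) / P.lg := by
    rw [norm_smul, Real.norm_of_nonneg hlam0]
    by_cases h : P.gradB x = 0
    · rw [h]; simp only [norm_zero, mul_zero]; positivity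
    · have hB : 0 < ‖P.gradB x‖ := norm_pos_iff.2 h
      have hRbf : 0 < P.Rbf x := lt_of_lt_of_le (by positivity) (hP.le_Rbf hxC)
      have hCs : P.CsStar L x ≤ ‖P.gradB x‖ * (cf + P.Rgbar * cL) := by
        have h1 : ⟪P.gradB x, P.f x P.θ⟫ ≤ ‖P.gradB x‖ * cf :=
          (real_inner_le_norm _ _).trans (by gcongr; exact hcf x hx)
        have h2 : -⟪P.gradB x, P.Rg x (gradient L x)⟫ ≤ ‖P.gradB x‖ * (P.Rgbar * cL) := by
          refine (neg_le_abs _).trans ((abs_real_inner_le_norm _ _).trans ?_)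
          gcongr
          refine ((P.Rg x).le_opNorm _).trans ?_
          gcongr
          exacts [hP.Rg_upper x hxC, hcL x hx]
        unfold CsStar
        linarith
      -- The numerator of `λ*` is of first order in `‖∇B‖` and the denominator of second order.
      -- Hence `λ* ‖∇B‖` stays bounded even near critical points of the barrier.
      have hstar : P.lamStar L x ≤ ‖P.gradB x‖ * (cf + P.Rgbar * cL) / (P.lg * ‖P.gradB x‖ ^ 2) := by
        simp only [lamStar, ne_eq, h, not_false_eq_true, if_true]
        refine max_le ?_ (by positivity)
        calc _ ≤ ‖P.gradB x‖ * (cf + P.Rgbar * cL) / P.Rbf x := by gcongr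
          _ ≤ _ := by
            gcongr
            exact hP.le_Rbf hxC
      calc _ ≤ ‖P.gradB x‖ * (cf + P.Rgbar * cL) / (P.lg * ‖P.gradB x‖ ^ 2) * ‖P.gradB x‖ := by
            gcongr
        _ = _ := by field_simp
  set q := P.lamStar L x • P.gradB x + gradient L x with hq
  have hqn : ‖q‖ ≤ cp := (norm_add_le _ _).trans (add_le_add hlam (hcL x hx))
  obtain ⟨u, hu⟩ := (hL.hjb x (hKC hx)).1
  have hham : P.Q x + 1 / 2 * ⟪u, P.R u⟫ + ⟪q, P.f x P.θ⟫ + ⟪q, P.g x u⟫ = 0 := by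
    rw [← hu]
    simp only [hamiltonian, r, hq, inner_add_left, inner_add_right, inner_smul_left, conj_trivial]
    ring
  have h1 : -⟪q, P.f x P.θ⟫ ≤ cp * cf := by
    refine (neg_le_abs _).trans ((abs_real_inner_le_norm _ _).trans ?_)
    gcongr
    exact hcf x hx
  have h2 : -⟪q, P.g x u⟫ ≤ cp * cg * ‖u‖ := by
    refine (neg_le_abs _).trans ((abs_real_inner_le_norm _ _).trans ?_)
    rw [mul_assoc]
    gcongr
    exact ((P.g x).le_opNorm _).trans (by gcongr; exact hcg x hx)
  have h3 : r₀ * ‖u‖ ^ 2 ≤ ⟪u, P.R u⟫ := by rw [real_inner_comm]; exact hR u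
  have h4 : cp * cg * ‖u‖ - r₀ * ‖u‖ ^ 2 / 2 ≤ (cp * cg) ^ 2 / (2 * r₀) := by
    rw [le_div_iff₀ (by positivity)]
    nlinarith [sq_nonneg (cp * cg - r₀ * ‖u‖)]
  linarith

/-- Uniform bounds on the regressor and on the offset of the Bellman error. -/
theorem Standing.exists_bellman_bound (hP : P.Standing) {L : Vec n → ℝ} (hL : P.SolvesHJB L)
    {K : Set (Vec n)} (hK : IsCompact K) (hKC : K ⊆ interior P.C) (M : ℝ) :
    ∃ c, 0 ≤ c ∧ ∀ x ∈ K, ∀ wc wa ϑ, ‖wa‖ ≤ P.Wabar → ‖ϑ‖ ≤ M → ‖P.omega x wc wa ϑ‖ ≤ c ∧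
      |P.bellman x wc wa ϑ - ⟪P.omega x wc wa ϑ, wc⟫| ≤ c := by
  obtain ⟨q, hq⟩ := hP.exists_Q_le hL hK hKC
  have hcpt : IsCompact (K ×ˢ (Metric.closedBall (0 : Vec b) P.Wabar ×ˢ
      Metric.closedBall (0 : Vec p) M)) :=
    hK.prod ((isCompact_closedBall _ _).prod (isCompact_closedBall _ _))
  have hsub : K ×ˢ (Metric.closedBall (0 : Vec b) P.Wabar ×ˢ Metric.closedBall (0 : Vec p) M)
      ⊆ interior P.C ×ˢ univ := prod_mono hKC (subset_univ _)
  obtain ⟨c₁, h₁⟩ := hcpt.exists_bound_of_continuousOn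
    (hP.continuousOn_vel_and_offset.1.mono hsub)
  obtain ⟨c₂, h₂⟩ := hcpt.exists_bound_of_continuousOn
    (hP.continuousOn_vel_and_offset.2.mono hsub)
  refine ⟨max (max c₁ (c₂ + q)) 0, le_max_right _ _, fun x hx wc wa ϑ hwa hϑ => ?_⟩
  have hmem : (x, wa, ϑ) ∈ K ×ˢ (Metric.closedBall (0 : Vec b) P.Wabar ×ˢ
      Metric.closedBall (0 : Vec p) M) := by simp [hx, hwa, hϑ]
  have hxD := hP.interior_subset_D (hKC hx)
  refine ⟨?_, ?_⟩
  · rw [hP.omega_eq hxD]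
    exact (h₁ _ hmem).trans ((le_max_left _ _).trans (le_max_left _ _))
  · rw [hP.bellman_eq hxD, hP.omega_eq hxD, real_inner_comm, add_sub_cancel_left]
    refine le_trans ?_ ((le_max_right c₁ _).trans (le_max_left _ _))
    have e : P.bellmanOffset x wa ϑ = (P.bellmanOffset x wa ϑ - P.Q x) + P.Q x := by ring
    rw [e]
    refine (abs_add_le _ _).trans (add_le_add (h₂ _ hmem) ?_)
    rw [abs_of_nonneg (hP.Q_nonneg x)]
    exact hq x hx

/-! ### The barrier -/

/-- A limit point of a sublevel set cannot lie on the boundary of `𝒞`, where the barrier tends to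
infinity, so the sublevel set is closed in the compact set `𝒞`. -/
theorem Standing.isCompact_sublevel (hP : P.Standing) (c : ℝ) :
    IsCompact {x | x ∈ interior P.C ∧ P.B x ≤ c} := by
  refine hP.isCompact_C.of_isClosed_subset (isClosed_of_closure_subset fun y hy => ?_)
    fun x hx => interior_subset hx.1
  have : (𝓝[{x | x ∈ interior P.C ∧ P.B x ≤ c}] y).NeBot := mem_closure_iff_nhdsWithin_neBot.1 hy
  have hle : 𝓝[{x | x ∈ interior P.C ∧ P.B x ≤ c}] y ≤ 𝓝[interior P.C] y :=
    nhdsWithin_mono y fun x hx => hx.1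
  have hev : ∀ᶠ x in 𝓝[{x | x ∈ interior P.C ∧ P.B x ≤ c}] y, P.B x ≤ c := by
    filter_upwards [self_mem_nhdsWithin] with x hx using hx.2
  by_cases hyC : y ∈ interior P.C
  · exact ⟨hyC, le_of_tendsto ((hP.B_contDiff.continuousOn y hyC).mono_left hle) hev⟩
  · have hyf : y ∈ frontier P.C :=
      ⟨closure_mono (fun x hx => interior_subset hx.1) hy, hyC⟩
    obtain ⟨x, h1, h2⟩ :=
      (hev.and (((hP.B_tendsto y hyf).mono_left hle).eventually_gt_atTop c)).exists
    exact absurd h1 (not_le.2 h2)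

/-- Above some level, the barrier decreases along the closed loop. -/
theorem Standing.exists_barrier_level (hP : P.Standing) :
    ∃ B₁, ∀ x ∈ interior P.C, ∀ wa ϑ, ‖wa‖ ≤ P.Wabar → B₁ < P.B x →
      ⟪P.gradB x, P.f x P.θ + P.g x (P.uHat x wa ϑ)⟫ ≤ -1 := by
  obtain ⟨cf, hcf⟩ := hP.isCompact_C.exists_bound_of_continuousOn
    (f := fun x => P.f x P.θ) (hP.continuous_Y.clm_apply continuous_const).continuousOn
  obtain ⟨cD, hcD⟩ := hP.isCompact_D.exists_bound_of_continuousOn hP.Dφ_continuousOn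
  have hlg := hP.lg_pos
  have hRb := hP.Rgbar_pos
  have hW := hP.Wabar_pos
  have h0C := interior_subset hP.zero_mem
  have hcf0 : 0 ≤ cf := (norm_nonneg _).trans (hcf 0 h0C)
  have hcD0 : 0 ≤ cD := (norm_nonneg _).trans (hcD 0 (hP.C_subset_D h0C))
  set d₁ := cf + P.Rgbar * (cD * P.Wabar) with hd₁
  set d₂ := P.k * P.varsig * P.lg with hd₂
  have hd₁0 : 0 ≤ d₁ := by positivity
  have hd₂0 : 0 < d₂ := mul_pos (mul_pos hP.k_pos hP.varsig_pos) hlg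
  -- Here `d₁` collects the terms linear in `y = ‖∇B‖` and `d₂` is the quadratic coefficient. Above
  -- this level `d₂ y ≥ d₁ + 1` and `y ≥ 1`, so `d₁ y - d₂ y² ≤ -y ≤ -1`.
  refine ⟨P.γ * ((d₁ + 1) / d₂ + 1), fun x hx wa ϑ hwa hB => ?_⟩
  have hxC := interior_subset hx
  set y := ‖P.gradB x‖ with hy
  have hy1 : (d₁ + 1) / d₂ + 1 < y :=
    lt_of_mul_lt_mul_left (hB.trans_le (hP.B_le_grad x hx)) hP.γ_pos.le
  have hq0 : 0 ≤ (d₁ + 1) / d₂ := by positivity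
  have hy2 : d₁ + 1 ≤ d₂ * y := by
    have := mul_le_mul_of_nonneg_left (show (d₁ + 1) / d₂ ≤ y by linarith) hd₂0.le
    rwa [mul_div_cancel₀ _ hd₂0.ne'] at this
  have h1 : ⟪P.gradB x, P.f x P.θ⟫ ≤ y * cf :=
    (real_inner_le_norm _ _).trans (by gcongr; exact hcf x hxC)
  have h2 : -⟪P.gradB x, P.Rg x (P.DφT x wa)⟫ ≤ y * (P.Rgbar * (cD * P.Wabar)) := by
    refine (neg_le_abs _).trans ((abs_real_inner_le_norm _ _).trans ?_)
    gcongr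
    refine ((P.Rg x).le_opNorm _).trans ?_
    gcongr
    · exact hP.Rg_upper x hxC
    · refine ((P.DφT x).le_opNorm _).trans ?_
      gcongr
      rw [DφT, LinearIsometryEquiv.norm_map]
      exact hcD x (hP.C_subset_D hxC)
  have h3 : d₂ * y ^ 2 ≤ P.lamHat x wa ϑ * P.Rbf x := by
    calc d₂ * y ^ 2 = P.k * P.varsig * (P.lg * y ^ 2) := by rw [hd₂]; ring
      _ ≤ _ := mul_le_mul (hP.le_lamHat x wa ϑ) (hP.le_Rbf hxC) (by positivity)
        ((mul_pos hP.k_pos hP.varsig_pos).le.trans (hP.le_lamHat x wa ϑ))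
  have h4 : ⟪P.gradB x, P.f x P.θ + P.g x (P.uHat x wa ϑ)⟫ = ⟪P.gradB x, P.f x P.θ⟫
      - ⟪P.gradB x, P.Rg x (P.DφT x wa)⟫ - P.lamHat x wa ϑ * P.Rbf x := by
    rw [g_uHat, inner_add_right, inner_sub_right, inner_neg_right, inner_smul_right, Rbf]
    ring
  rw [h4]
  nlinarith

end ACIL

theorem Icc_subset_horizon {t₀ t : ℝ} {t₁ : EReal} (ht : t ∈ horizon t₀ t₁) :
    Icc t₀ t ⊆ horizon t₀ t₁ := fun _ hτ =>
  ⟨hτ.1, (EReal.coe_le_coe_iff.2 hτ.2).trans_lt ht.2⟩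

namespace ACIL

variable {n m p b N : ℕ} {P : ACIL n m p b N} {s : Signals n p b} {t₀ : ℝ} {t₁ : EReal}

/-! ### Forward invariance -/

theorem IsTrajectory.norm_Wa_le (hs : P.IsTrajectory s t₀ t₁) (hP : P.Standing) {t : ℝ}
    (ht : t ∈ horizon t₀ t₁) (hx : ∀ τ ∈ Ico t₀ t, s.x τ ∈ interior P.C) :
    ∀ τ ∈ Icc t₀ t, ‖s.Wa τ‖ ≤ P.Wabar := by
  have hsub := Icc_subset_horizon ht
  intro τ hτ
  have key := le_of_deriv_right_nonpos_above (f := fun τ => ‖s.Wa τ‖ ^ 2) (c := P.Wabar ^ 2)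
    (f' := fun τ => 2 * ⟪s.Wa τ, P.actorRHS s τ⟫) (a := t₀) (b := t)
    ((hs.Wa_cont.mono hsub).norm.pow 2)
    (fun u hu => (hs.actor u (hsub (Ico_subset_Icc_self hu))
      fun v hv => hx v ⟨hv.1, hv.2.trans_lt hu.2⟩).norm_sq)
    (pow_le_pow_left₀ (norm_nonneg _) hs.Wa_init 2)
    (fun u _ hlt => mul_nonpos_of_nonneg_of_nonpos two_pos.le
      (inner_proj_nonpos hP.Wabar_pos hP.tol_pos hlt _)) τ hτ
  exact (sq_le_sq₀ (norm_nonneg _) hP.Wabar_pos.le).1 key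

/-- The time `t` is excluded because the state is not yet known to be interior there. This is the
form that the exclusion of a first exit time requires. -/
theorem IsTrajectory.B_le (hs : P.IsTrajectory s t₀ t₁) (hP : P.Standing) {B₁ : ℝ}
    (hB₁ : ∀ x ∈ interior P.C, ∀ wa ϑ, ‖wa‖ ≤ P.Wabar → B₁ < P.B x →
      ⟪P.gradB x, P.f x P.θ + P.g x (P.uHat x wa ϑ)⟫ ≤ -1) {t : ℝ}
    (ht : t ∈ horizon t₀ t₁) (hx : ∀ τ ∈ Ico t₀ t, s.x τ ∈ interior P.C) :
    ∀ τ ∈ Ico t₀ t, P.B (s.x τ) ≤ max B₁ (P.B (s.x t₀) - (τ - t₀)) := by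
  intro τ hτ
  have hsub := Icc_subset_horizon ht
  have hIcc : Icc t₀ τ ⊆ Ico t₀ t := fun u hu => ⟨hu.1, hu.2.trans_lt hτ.2⟩
  have hWa := hs.norm_Wa_le hP ht hx
  have key := le_max_of_deriv_right_le_neg_above (f := fun τ => P.B (s.x τ)) (c := B₁) (q := 1)
    (f' := fun τ => ⟪P.gradB (s.x τ),
      P.f (s.x τ) P.θ + P.g (s.x τ) (P.uHat (s.x τ) (s.Wa τ) (s.θh τ))⟫)
    (a := t₀) (b := τ) zero_le_one
    (hP.B_contDiff.continuousOn.comp (hs.x_cont.mono (hIcc.trans (Ico_subset_Icc_self.trans hsub)))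
      fun u hu => hx u (hIcc hu))
    (fun u hu => ?_) (fun u hu hlt => ?_) τ ⟨hτ.1, le_rfl⟩
  · simpa using key
  · have hu' := hIcc (Ico_subset_Icc_self hu)
    have hdiff : DifferentiableAt ℝ P.B (s.x u) :=
      (hP.B_contDiff.contDiffAt (isOpen_interior.mem_nhds (hx u hu'))).differentiableAt one_ne_zero
    have := hdiff.hasFDerivAt.comp_hasDerivWithinAt u (hs.plant u
      (hsub (Ico_subset_Icc_self hu')) fun v hv => hx v ⟨hv.1, hv.2.trans_lt hu'.2⟩)
    rwa [← inner_gradient_left] at this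
  · have hu' := hIcc (Ico_subset_Icc_self hu)
    exact hB₁ _ (hx u hu') _ _ (hWa u (Ico_subset_Icc_self hu')) hlt

/-- At a first exit time the state would lie on the frontier, where the barrier tends to infinity.
Up to that time, however, the barrier is at most the larger of `B₁` and its initial value. -/
theorem IsTrajectory.mem_interior (hs : P.IsTrajectory s t₀ t₁) (hP : P.Standing) {t : ℝ}
    (ht : t ∈ horizon t₀ t₁) : s.x t ∈ interior P.C := by
  obtain ⟨B₁, hB₁⟩ := hP.exists_barrier_level
  have hsub := Icc_subset_horizon ht
  refine forall_mem_Icc_of_real_induction (a := t₀) (b := t) (p := fun t => s.x t ∈ interior P.C)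
    (fun τ hτ hbefore => ?_) (fun τ hτ hupto => ?_) t ⟨ht.1, le_rfl⟩
  · rcases hτ.1.eq_or_lt with rfl | hlt
    · exact hs.x_init
    by_contra hout
    have hτh := hsub hτ
    have hBle := hs.B_le hP hB₁ hτh hbefore
    have hlim : Tendsto s.x (𝓝[Ico t₀ τ] τ) (𝓝[interior P.C] (s.x τ)) :=
      tendsto_nhdsWithin_iff.2 ⟨(hs.x_cont τ hτh).mono fun u hu =>
        Icc_subset_horizon hτh (Ico_subset_Icc_self hu),
        by filter_upwards [self_mem_nhdsWithin] with u hu using hbefore u hu⟩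
    have hne : (𝓝[Ico t₀ τ] τ).NeBot := by
      rw [← mem_closure_iff_nhdsWithin_neBot, closure_Ico hlt.ne]
      exact ⟨hlt.le, le_rfl⟩
    have hcl : s.x τ ∈ closure (interior P.C) :=
      mem_closure_iff_nhdsWithin_neBot.2 (hlim.neBot)
    have hfr : s.x τ ∈ frontier P.C := ⟨closure_mono interior_subset hcl, hout⟩
    obtain ⟨u, hu₁, hu₂⟩ := ((((hP.B_tendsto _ hfr).comp hlim).eventually_gt_atTop
      (max B₁ (P.B (s.x t₀)))).and self_mem_nhdsWithin).exists
    exact absurd ((hBle u hu₂).trans (max_le_max_left _ (by linarith [hu₂.1]))) (not_le.2 hu₁)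
  · exact ((hs.plant τ (hsub (Ico_subset_Icc_self hτ)) hupto).continuousWithinAt.mono
      Ioi_subset_Ici_self).eventually (isOpen_interior.mem_nhds (hupto τ ⟨hτ.1, le_rfl⟩))

theorem IsTrajectory.norm_Wa_le_of_mem (hs : P.IsTrajectory s t₀ t₁) (hP : P.Standing) {t : ℝ}
    (ht : t ∈ horizon t₀ t₁) : ‖s.Wa t‖ ≤ P.Wabar :=
  hs.norm_Wa_le hP ht (fun _ hτ => hs.mem_interior hP (Icc_subset_horizon ht
    (Ico_subset_Icc_self hτ))) t ⟨ht.1, le_rfl⟩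

theorem IsTrajectory.mem_interior_Icc (hs : P.IsTrajectory s t₀ t₁) (hP : P.Standing) {t : ℝ}
    (ht : t ∈ horizon t₀ t₁) : ∀ τ ∈ Icc t₀ t, s.x τ ∈ interior P.C := fun _ hτ =>
  hs.mem_interior hP (Icc_subset_horizon ht hτ)

/-- The barrier decreases to the level `B₁` and stays below it. -/
theorem IsTrajectory.B_le_of_mem (hs : P.IsTrajectory s t₀ t₁) (hP : P.Standing) {B₁ : ℝ}
    (hB₁ : ∀ x ∈ interior P.C, ∀ wa ϑ, ‖wa‖ ≤ P.Wabar → B₁ < P.B x →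
      ⟪P.gradB x, P.f x P.θ + P.g x (P.uHat x wa ϑ)⟫ ≤ -1) {t : ℝ}
    (ht : t ∈ horizon t₀ t₁) : P.B (s.x t) ≤ max B₁ (P.B (s.x t₀) - (t - t₀)) := by
  -- The horizon is open on the right, so the half-open estimate can be applied on a slightly longer
  -- interval that contains `t`.
  obtain ⟨t', htt', ht'⟩ : ∃ t' : ℝ, t < t' ∧ (t' : EReal) < t₁ := by
    obtain ⟨q, hq₁, hq₂⟩ := EReal.lt_iff_exists_real_btwn.1 ht.2
    exact ⟨q, EReal.coe_lt_coe_iff.1 hq₁, hq₂⟩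
  have ht'h : t' ∈ horizon t₀ t₁ := ⟨ht.1.trans htt'.le, ht'⟩
  exact hs.B_le hP hB₁ ht'h (fun τ hτ => hs.mem_interior_Icc hP ht'h τ (Ico_subset_Icc_self hτ))
    t ⟨ht.1, htt'⟩

/-! ### The identifier -/

/-- The parameter error is bounded and becomes smaller than one, uniformly over the
trajectories. -/
theorem exists_identifier_bound (P : ACIL n m p b N) {αlo αhi : ℝ → ℝ}
    (hαlo : IsClassKInfty αlo) (hαhi : IsClassK αhi) {kθ : ℝ} (hkθ : 0 < kθ) {a : ℝ} (ha : 0 < a) :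
    ∃ M Tθ : ℝ, 0 ≤ Tθ ∧ ∀ (t₀ : ℝ) (t₁ : EReal) (s : Signals n p b),
      P.IsIdentified s αlo αhi kθ t₀ t₁ → ‖P.θ - s.θh t₀‖ ≤ a → ∀ t ∈ horizon t₀ t₁,
        ‖P.θ - s.θh t‖ ≤ M ∧ (t₀ + Tθ ≤ t → ‖P.θ - s.θh t‖ ≤ 1) := by
  -- The Lyapunov function never exceeds `αhi a`, so the error never exceeds any `M` with `αlo M >
  -- αhi a`. Such an `M` exists because `αlo` is unbounded.
  obtain ⟨M, hM, hM0⟩ :=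
    ((hαlo.unbounded.eventually_gt_atTop (αhi a)).and (eventually_ge_atTop 0)).exists
  have hlo1 : 0 < αlo 1 := by
    rw [← hαlo.zero]
    exact hαlo.strictMonoOn (mem_Ici.2 le_rfl) (mem_Ici.2 zero_le_one) one_pos
  -- Once the error is at most `η`, the Lyapunov function stays below `αlo 1` and the error stays
  -- below one.
  obtain ⟨η, hη, hη0⟩ : ∃ η, αhi η < αlo 1 ∧ 0 < η := by
    have h : Tendsto αhi (𝓝[>] 0) (𝓝 0) := by
      have := hαhi.continuousOn 0 (mem_Ici.2 le_rfl)
      rw [ContinuousWithinAt, hαhi.zero] at this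
      exact this.mono_left (nhdsWithin_mono _ Ioi_subset_Ici_self)
    exact ((h.eventually_lt_const hlo1).and self_mem_nhdsWithin).exists
  have hhia : 0 ≤ αhi a := by
    rw [← hαhi.zero]
    exact hαhi.strictMonoOn.monotoneOn (mem_Ici.2 le_rfl) (mem_Ici.2 ha.le) ha.le
  have hle_of_lt : ∀ r c : ℝ, 0 ≤ c → αlo r < αlo c → 0 ≤ r → r ≤ c := fun r c hc h hr =>
    not_lt.1 fun hcr => lt_asymm h (hαlo.strictMonoOn (mem_Ici.2 hc) (mem_Ici.2 hr) hcr)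
  have hlo_nonneg : ∀ r : ℝ, 0 ≤ r → 0 ≤ αlo r := fun r hr => by
    rw [← hαlo.zero]
    exact hαlo.strictMonoOn.monotoneOn (mem_Ici.2 le_rfl) (mem_Ici.2 hr) hr
  refine ⟨M, αhi a / (kθ * η ^ 2) + 1, by positivity, fun t₀ t₁ s hid hinit t ht => ?_⟩
  obtain ⟨V, hV, hVc, hVd⟩ := hid
  choose! d hd using hVd
  have hsub := Icc_subset_horizon ht
  have hmono : ∀ τ ∈ Icc t₀ t, V (P.θ - s.θh t) t ≤ V (P.θ - s.θh τ) τ := fun τ hτ =>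
    le_of_deriv_right_nonpos_above (f := fun τ => V (P.θ - s.θh τ) τ) (f' := d)
      (hVc.mono ((Icc_subset_Icc_left hτ.1).trans hsub))
      (fun u hu => (hd u (hsub ⟨hτ.1.trans hu.1, hu.2.le⟩)).2) le_rfl
      (fun u hu _ => (hd u (hsub ⟨hτ.1.trans hu.1, hu.2.le⟩)).1.trans
        (mul_nonpos_of_nonpos_of_nonneg (neg_nonpos.2 hkθ.le) (sq_nonneg _))) t ⟨hτ.2, le_rfl⟩
  have hV0 : V (P.θ - s.θh t₀) t₀ ≤ αhi a :=
    (hV _ t₀ (hsub ⟨le_rfl, ht.1⟩)).2.trans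
      (hαhi.strictMonoOn.monotoneOn (mem_Ici.2 (norm_nonneg _)) (mem_Ici.2 ha.le) hinit)
  refine ⟨hle_of_lt _ _ hM0 ?_ (norm_nonneg _), fun htT => ?_⟩
  · exact ((hV _ t ht).1.trans ((hmono t₀ ⟨le_rfl, ht.1⟩).trans hV0)).trans_lt hM
  · by_cases hex : ∃ τ ∈ Icc t₀ t, ‖P.θ - s.θh τ‖ ≤ η
    · obtain ⟨τ, hτ, hτη⟩ := hex
      refine hle_of_lt _ _ zero_le_one ?_ (norm_nonneg _)
      calc αlo ‖P.θ - s.θh t‖ ≤ V (P.θ - s.θh t) t := (hV _ t ht).1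
        _ ≤ V (P.θ - s.θh τ) τ := hmono τ hτ
        _ ≤ αhi ‖P.θ - s.θh τ‖ := (hV _ τ (hsub hτ)).2
        _ ≤ αhi η := hαhi.strictMonoOn.monotoneOn (mem_Ici.2 (norm_nonneg _)) (mem_Ici.2 hη0.le) hτη
        _ < αlo 1 := hη
    · push Not at hex
      -- While the error exceeds `η`, the Lyapunov function falls at rate `kθ η²`, and over the time
      -- `Tθ` it would become negative. The level `-1` lies below all its values, so the other
      -- alternative of the maximum cannot occur.
      have key := le_max_of_deriv_right_le_neg_above (f := fun τ => V (P.θ - s.θh τ) τ) (f' := d)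
        (c := -1) (q := kθ * η ^ 2) (by positivity) (hVc.mono hsub)
        (fun u hu => (hd u (hsub (Ico_subset_Icc_self hu))).2)
        (fun u hu _ => (hd u (hsub (Ico_subset_Icc_self hu))).1.trans (by
          have := pow_le_pow_left₀ hη0.le (hex u (Ico_subset_Icc_self hu)).le 2
          nlinarith)) t ⟨ht.1, le_rfl⟩
      have h0 : 0 ≤ V (P.θ - s.θh t) t := (hlo_nonneg _ (norm_nonneg _)).trans (hV _ t ht).1
      have h1 : kθ * η ^ 2 * (αhi a / (kθ * η ^ 2) + 1) = αhi a + kθ * η ^ 2 := by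
        field_simp
      have h2 : kθ * η ^ 2 * (αhi a / (kθ * η ^ 2) + 1) ≤ kθ * η ^ 2 * (t - t₀) := by
        gcongr; linarith
      have h3 : 0 < kθ * η ^ 2 := by positivity
      rcases le_max_iff.1 key with h | h <;> linarith

end ACIL

/-! ### Information gathered over an excitation window -/

theorem inner_outer_self {d : ℕ} (ω v : Vec d) : ⟪outer ω v, v⟫ = ⟪ω, v⟫ ^ 2 := by
  simp [outer, inner_smul_left, sq]

/-- An inequality rather than an equality, so that it also covers `N = 0`, where the left side
vanishes by the convention for division by zero. -/
theorem div_natCast_mul_natCast_mul_le {η c : ℝ} (hη : 0 ≤ η) (hc : 0 ≤ c) (N : ℕ) :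
    η / N * (N * c) ≤ η * c := by
  rcases Nat.eq_zero_or_pos N with rfl | hN
  · simp; positivity
  · have : (N : ℝ) ≠ 0 := by positivity
    rw [← mul_assoc, div_mul_cancel₀ _ this]

/-- Growth of the information matrix `Γ⁻¹` over a window on which `M` is exciting. -/
theorem le_inner_inverse_of_excitation {d : ℕ} {Γ M A : ℝ → Lin d d} {a b β c η : ℝ} (hβ : 0 < β)
    (hab : a ≤ b) (hη : 0 ≤ η) (hc : 0 < c)
    (hΓ : ContinuousOn Γ (Icc a b)) (hpd : ∀ t ∈ Icc a b, IsPosDefMap (Γ t))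
    (hΓ' : ∀ t ∈ Ico a b, HasDerivWithinAt Γ (β • Γ t - Γ t ∘L M t ∘L Γ t) (Ici t) t)
    (hA : ∀ t ∈ Ico a b, ∀ v, 0 ≤ ⟪A t v, v⟫)
    (hAM : ∀ t ∈ Ico a b, ∀ v, η * ⟪A t v, v⟫ ≤ ⟪M t v, v⟫)
    (hexc : c • (1 : Lin d d) ≤ ∫ τ in a..b, A τ) (v : Vec d) :
    Real.exp (-β * (b - a)) * (η * c) * ‖v‖ ^ 2 ≤ ⟪Ring.inverse (Γ b) v, v⟫ := by
  have hexc' : c * ‖v‖ ^ 2 ≤ ⟪(∫ τ in a..b, A τ) v, v⟫ := by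
    have := ContinuousLinearMap.IsPositive.inner_nonneg_left
      ((ContinuousLinearMap.le_def _ _).1 hexc) v
    simp only [sub_apply, inner_sub_left, smul_apply,
      one_apply_eq_self, inner_smul_left, conj_trivial,
      real_inner_self_eq_norm_sq] at this
    linarith
  -- If `A` is not integrable, its integral is zero by convention, and the excitation inequality
  -- with `c > 0` forces `v = 0`.
  by_cases hint : IntervalIntegrable A volume a b
  · set Λ : Lin d d →L[ℝ] ℝ := innerSL ℝ v ∘L ContinuousLinearMap.apply ℝ (Vec d) v
    have hΛ : ∀ B : Lin d d, Λ B = ⟪B v, v⟫ := fun B => by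
      simp [Λ, real_inner_comm]
    have hint' : IntegrableOn (fun t => Λ (A t)) (Icc a b) := by
      rw [integrableOn_Icc_iff_integrableOn_Ioc]
      exact Λ.integrable_comp hint.1
    have key := le_inner_inverse_of_riccati hβ hab hΓ hpd hΓ' (v := v) (q := fun t => η * Λ (A t))
      (hint'.const_mul η)
      (fun t ht => mul_nonneg hη (by rw [hΛ]; exact hA t ht v))
      (fun t ht => by rw [hΛ]; exact hAM t ht v)
    rw [intervalIntegral.integral_const_mul, Λ.intervalIntegral_comp_comm hint, hΛ] at key
    refine le_trans ?_ key
    rw [mul_assoc, mul_assoc]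
    gcongr
  · rw [intervalIntegral.integral_undef hint] at hexc'
    have hv : ‖v‖ ^ 2 ≤ 0 := by
      have h : c * ‖v‖ ^ 2 ≤ 0 := by simpa using hexc'
      nlinarith
    have hv0 : v = 0 := by
      rw [← norm_eq_zero]; exact pow_eq_zero_iff two_ne_zero |>.1 (le_antisymm hv (sq_nonneg _))
    simp [hv0]

namespace ACIL

variable {n m p b N : ℕ} {P : ACIL n m p b N} {s : Signals n p b} {t₀ : ℝ} {t₁ : EReal}

/-! ### The least squares gain -/

/-- The rate `η_c1 ψ + (η_c2 / N) ∑ ψ_i` at which the regressors add information. -/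
noncomputable def infoRate (P : ACIL n m p b N) (s : Signals n p b) (t : ℝ) : Lin b b :=
  P.ηc1 • P.psi s (s.x t) t + (P.ηc2 / N) • ∑ i, P.psi s (P.pt s i t) t

theorem gainRHS_eq (P : ACIL n m p b N) (s : Signals n p b) (t : ℝ) :
    P.gainRHS s t = P.β • s.Γ t - s.Γ t ∘L P.infoRate s t ∘L s.Γ t := by
  simp only [gainRHS, infoRate, ContinuousLinearMap.add_comp, ContinuousLinearMap.comp_add,
    ContinuousLinearMap.smul_comp, ContinuousLinearMap.comp_smul]
  abel

theorem isPositive_psi (P : ACIL n m p b N) (s : Signals n p b) (y : Vec n) (t : ℝ) :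
    (P.psi s y t).IsPositive :=
  (InnerProductSpace.isPositive_rankOne_self _).smul_of_nonneg (by positivity)

theorem Standing.isPositive_infoRate (hP : P.Standing) (s : Signals n p b) (t : ℝ) :
    (P.infoRate s t).IsPositive :=
  ((P.isPositive_psi s _ t).smul_of_nonneg hP.ηc1_pos.le).add
    ((ContinuousLinearMap.isPositive_sum _ fun _ _ => P.isPositive_psi s _ t).smul_of_nonneg
      (div_nonneg hP.ηc2_pos.le (Nat.cast_nonneg N)))

theorem inner_psi_self (P : ACIL n m p b N) (s : Signals n p b) (y : Vec n) (t : ℝ) (v : Vec b) :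
    ⟪P.psi s y t v, v⟫ = ⟪P.om s y t, v⟫ ^ 2 / P.rho s y t ^ 2 := by
  simp only [psi, smul_apply, inner_smul_left, conj_trivial, inner_outer_self]
  ring

theorem inner_psi_nonneg (P : ACIL n m p b N) (s : Signals n p b) (y : Vec n) (t : ℝ)
    (v : Vec b) : 0 ≤ ⟪P.psi s y t v, v⟫ := (P.isPositive_psi s y t).inner_nonneg_left v

theorem inner_infoRate_self (P : ACIL n m p b N) (s : Signals n p b) (t : ℝ) (v : Vec b) :
    ⟪P.infoRate s t v, v⟫ = P.ηc1 * ⟪P.psi s (s.x t) t v, v⟫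
      + P.ηc2 / N * ∑ i, ⟪P.psi s (P.pt s i t) t v, v⟫ := by
  simp [infoRate, inner_add_left, inner_smul_left, sum_inner]

theorem Standing.one_le_rho_sq (hP : P.Standing) {t : ℝ} (hΓ : ∀ v, 0 ≤ ⟪s.Γ t v, v⟫)
    (y : Vec n) : 1 ≤ P.rho s y t ^ 2 := by
  have h := hΓ (P.om s y t)
  rw [real_inner_comm] at h
  have h2 : 0 ≤ P.ν * ⟪P.om s y t, s.Γ t (P.om s y t)⟫ := mul_nonneg hP.ν_pos.le h
  rw [rho, Real.sq_sqrt (by linarith)]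
  linarith

theorem Standing.norm_psi_le (hP : P.Standing) {t : ℝ} (hΓ : ∀ v, 0 ≤ ⟪s.Γ t v, v⟫)
    {y : Vec n} {c : ℝ} (hc : ‖P.om s y t‖ ≤ c) : ‖P.psi s y t‖ ≤ c ^ 2 := by
  have h1 := hP.one_le_rho_sq hΓ y
  rw [psi, norm_smul, outer, InnerProductSpace.norm_rankOne, Real.norm_of_nonneg (by positivity),
    one_div, ← sq]
  calc _ ≤ 1 * ‖P.om s y t‖ ^ 2 := by gcongr; exact inv_le_one_of_one_le₀ h1
    _ ≤ c ^ 2 := by rw [one_mul]; gcongr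

theorem Standing.norm_infoRate_le (hP : P.Standing) {t : ℝ} (hΓ : ∀ v, 0 ≤ ⟪s.Γ t v, v⟫)
    {c : ℝ} (hx : ‖P.om s (s.x t) t‖ ≤ c) (hpt : ∀ i, ‖P.om s (P.pt s i t) t‖ ≤ c) :
    ‖P.infoRate s t‖ ≤ (P.ηc1 + P.ηc2) * c ^ 2 := by
  have h1 := hP.ηc1_pos.le
  have h2 := hP.ηc2_pos.le
  calc ‖P.infoRate s t‖ ≤ ‖P.ηc1 • P.psi s (s.x t) t‖
        + ‖(P.ηc2 / N) • ∑ i, P.psi s (P.pt s i t) t‖ := norm_add_le _ _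
    _ ≤ P.ηc1 * c ^ 2 + P.ηc2 / N * (N * c ^ 2) := by
      rw [norm_smul, norm_smul, Real.norm_of_nonneg h1, Real.norm_of_nonneg (by positivity)]
      gcongr
      · exact hP.norm_psi_le hΓ hx
      · refine (norm_sum_le _ _).trans ?_
        refine (Finset.sum_le_card_nsmul _ _ _ fun i _ => hP.norm_psi_le hΓ (hpt i)).trans ?_
        simp
    _ ≤ P.ηc1 * c ^ 2 + P.ηc2 * c ^ 2 := by
      exact add_le_add le_rfl (div_natCast_mul_natCast_mul_le h2 (sq_nonneg c) N)
    _ = _ := by ring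

/-- Uniform bounds on the regressor and on the Bellman error, in terms of the critic error. -/
theorem Standing.exists_del_bound (hP : P.Standing) {L : Vec n → ℝ} (hL : P.SolvesHJB L)
    (W : Vec b) {K : Set (Vec n)} (hK : IsCompact K) (hKC : K ⊆ interior P.C) (M : ℝ) :
    ∃ c, 0 ≤ c ∧ ∀ (s : Signals n p b) (t : ℝ), ‖s.Wa t‖ ≤ P.Wabar → ‖P.θ - s.θh t‖ ≤ M →
      ∀ y ∈ K, ‖P.om s y t‖ ≤ c ∧ |P.del s y t + ⟪P.om s y t, W - s.Wc t⟫| ≤ c := by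
  obtain ⟨c, hc0, hc⟩ := hP.exists_bellman_bound hL hK hKC (‖P.θ‖ + M)
  refine ⟨c + c * ‖W‖, by positivity, fun s t hWa hθ y hy => ?_⟩
  have hϑ : ‖s.θh t‖ ≤ ‖P.θ‖ + M := by
    calc ‖s.θh t‖ = ‖P.θ - (P.θ - s.θh t)‖ := by rw [sub_sub_cancel]
      _ ≤ _ := (norm_sub_le _ _).trans (add_le_add le_rfl hθ)
  obtain ⟨h1, h2⟩ := hc y hy (s.Wc t) (s.Wa t) (s.θh t) hWa hϑ
  refine ⟨h1.trans (le_add_of_nonneg_right (by positivity)), ?_⟩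
  have e : P.del s y t + ⟪P.om s y t, W - s.Wc t⟫
      = (P.del s y t - ⟪P.om s y t, s.Wc t⟫) + ⟪P.om s y t, W⟫ := by
    rw [inner_sub_right]; ring
  rw [e]
  refine (abs_add_le _ _).trans (add_le_add h2 ((abs_real_inner_le_norm _ _).trans ?_))
  gcongr
  exact h1

/-- On a finite interval the states and extrapolation points lie in a compact subset of the
interior, and the actor weights and parameter estimates are bounded. So the regressors are bounded.
Where the form of `Γ` is nonnegative, `ρ ≥ 1`, and the information rate is bounded as well. -/
theorem IsTrajectory.isPosDefMap_gain (hs : P.IsTrajectory s t₀ t₁) (hP : P.Standing)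
    {L : Vec n → ℝ} (hL : P.SolvesHJB L) (ht₀ : 0 ≤ t₀) {t : ℝ} (ht : t ∈ horizon t₀ t₁) :
    IsPosDefMap (s.Γ t) := by
  have hsub := Icc_subset_horizon ht
  have hint := hs.mem_interior_Icc hP ht
  obtain ⟨KX, hKX, hKXC, hX⟩ := hP.X_mem
  obtain ⟨M, hM⟩ := isCompact_Icc.exists_bound_of_continuousOn
    (f := fun τ => P.θ - s.θh τ) (continuousOn_const.sub (hs.θh_cont.mono hsub))
  have hK : IsCompact (s.x '' Icc t₀ t ∪ KX) :=
    (isCompact_Icc.image_of_continuousOn (hs.x_cont.mono hsub)).union hKX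
  have hKC : s.x '' Icc t₀ t ∪ KX ⊆ interior P.C :=
    union_subset (image_subset_iff.2 hint) hKXC
  obtain ⟨c, -, hc⟩ := hP.exists_del_bound hL 0 hK hKC M
  refine isPosDefMap_of_riccati (a := t₀) (b := t) (M := P.infoRate s) (β := P.β)
    (Mbar := (P.ηc1 + P.ηc2) * c ^ 2) (hs.Γ_cont.mono hsub)
    (fun τ hτ => ?_) (fun τ => (hP.isPositive_infoRate s τ).isSelfAdjoint) (fun τ hτ hnn => ?_)
    (hs.Γ_init ▸ hP.Γ₀_posDef) t ⟨ht.1, le_rfl⟩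
  · have hτ' := Ico_subset_Icc_self hτ
    rw [← gainRHS_eq]
    exact hs.gain τ (hsub hτ') (hs.mem_interior_Icc hP (hsub hτ'))
  · have hτ' := Ico_subset_Icc_self hτ
    have hb := hc s τ (hs.norm_Wa_le_of_mem hP (hsub hτ')) (hM τ hτ')
    exact hP.norm_infoRate_le hnn (hb _ (Or.inl ⟨τ, hτ', rfl⟩)).1 fun i =>
      (hb _ (Or.inr (hX i _ (hint τ hτ') τ (ht₀.trans hτ.1)))).1

theorem IsTrajectory.hasDerivWithinAt_gain (hs : P.IsTrajectory s t₀ t₁) (hP : P.Standing)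
    {t : ℝ} (ht : t ∈ horizon t₀ t₁) :
    HasDerivWithinAt s.Γ (P.β • s.Γ t - s.Γ t ∘L P.infoRate s t ∘L s.Γ t) (Ici t) t := by
  rw [← gainRHS_eq]
  exact hs.gain t ht (hs.mem_interior_Icc hP ht)

theorem IsTrajectory.le_inner_inverse_gain (hs : P.IsTrajectory s t₀ t₁) (hP : P.Standing)
    {L : Vec n → ℝ} (hL : P.SolvesHJB L) (ht₀ : 0 ≤ t₀) {T η c t : ℝ} (hT : 0 < T) (hη : 0 ≤ η)
    (hc : 0 < c) (ht : t ∈ horizon t₀ t₁) (htT : t₀ + T ≤ t) {A : ℝ → Lin b b}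
    (hA : ∀ τ ∈ Ico (t - T) t, ∀ v, 0 ≤ ⟪A τ v, v⟫)
    (hAM : ∀ τ ∈ Ico (t - T) t, ∀ v, η * ⟪A τ v, v⟫ ≤ ⟪P.infoRate s τ v, v⟫)
    (hexc : c • (1 : Lin b b) ≤ ∫ τ in (t - T)..t, A τ) (v : Vec b) :
    Real.exp (-P.β * T) * (η * c) * ‖v‖ ^ 2 ≤ ⟪Ring.inverse (s.Γ t) v, v⟫ := by
  have hsub : Icc (t - T) t ⊆ horizon t₀ t₁ :=
    (Icc_subset_Icc_left (by linarith)).trans (Icc_subset_horizon ht)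
  have hle : t - T ≤ t := by linarith
  have := le_inner_inverse_of_excitation (M := P.infoRate s) (A := A) (a := t - T) (b := t)
    hP.β_pos hle hη hc (hs.Γ_cont.mono hsub)
    (fun τ hτ => hs.isPosDefMap_gain hP hL ht₀ (hsub hτ))
    (fun τ hτ => hs.hasDerivWithinAt_gain hP (hsub (Ico_subset_Icc_self hτ))) hA hAM hexc v
  rwa [sub_sub_cancel] at this

theorem Standing.psi_le_infoRate (hP : P.Standing) (s : Signals n p b) (t : ℝ) (v : Vec b) :
    P.ηc1 * ⟪P.psi s (s.x t) t v, v⟫ ≤ ⟪P.infoRate s t v, v⟫ := by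
  rw [inner_infoRate_self]
  exact le_add_of_nonneg_right (mul_nonneg (div_nonneg hP.ηc2_pos.le (Nat.cast_nonneg N))
    (Finset.sum_nonneg fun i _ => P.inner_psi_nonneg s _ t v))

/-- The mean `(1 / N) ∑ ψ_i` over the extrapolation points. -/
noncomputable def meanPsi (P : ACIL n m p b N) (s : Signals n p b) (t : ℝ) : Lin b b :=
  (1 / (N : ℝ)) • ∑ i, P.psi s (P.pt s i t) t

theorem inner_meanPsi_self (P : ACIL n m p b N) (s : Signals n p b) (t : ℝ) (v : Vec b) :
    ⟪P.meanPsi s t v, v⟫ = 1 / N * ∑ i, ⟪P.psi s (P.pt s i t) t v, v⟫ := by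
  rw [meanPsi, smul_apply, inner_smul_left, sum_apply, sum_inner, conj_trivial]

theorem inner_meanPsi_nonneg (P : ACIL n m p b N) (s : Signals n p b) (t : ℝ) (v : Vec b) :
    0 ≤ ⟪P.meanPsi s t v, v⟫ := by
  rw [inner_meanPsi_self]
  exact mul_nonneg (by positivity) (Finset.sum_nonneg fun i _ => P.inner_psi_nonneg s _ t v)

theorem Standing.meanPsi_le_infoRate (hP : P.Standing) (s : Signals n p b) (t : ℝ) (v : Vec b) :
    P.ηc2 * ⟪P.meanPsi s t v, v⟫ ≤ ⟪P.infoRate s t v, v⟫ := by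
  rw [inner_infoRate_self, inner_meanPsi_self, ← mul_assoc, mul_one_div]
  exact le_add_of_nonneg_left (mul_nonneg hP.ηc1_pos.le (P.inner_psi_nonneg s _ t v))

theorem IsExciting.le_inner_meanPsi {T c₁ c₂ c₃ : ℝ} (he : P.IsExciting s T c₁ c₂ c₃ t₀ t₁)
    {t : ℝ} (ht : t ∈ horizon t₀ t₁) (v : Vec b) :
    ⟪(c₂ • (1 : Lin b b)) v, v⟫ ≤ ⟪P.meanPsi s t v, v⟫ := by
  have := ContinuousLinearMap.IsPositive.inner_nonneg_left
    ((ContinuousLinearMap.le_def _ _).1 (he.inst t ht)) v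
  rwa [sub_apply, inner_sub_left, sub_nonneg] at this

theorem IsExciting.le_integral_meanPsi {T c₁ c₂ c₃ : ℝ} (he : P.IsExciting s T c₁ c₂ c₃ t₀ t₁)
    {t : ℝ} (ht : t ∈ horizon t₀ t₁) (htT : t₀ + T ≤ t) :
    c₃ • (1 : Lin b b) ≤ ∫ τ in (t - T)..t, P.meanPsi s τ := by
  have := he.extrap (t - T) (by linarith) (by rwa [sub_add_cancel])
  rw [sub_add_cancel, ← intervalIntegral.integral_smul] at this
  exact this

/-- Excitation bounds the information matrix `Γ⁻¹` from below after one window. -/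
theorem Standing.exists_le_inner_inverse_gain (hP : P.Standing) {L : Vec n → ℝ}
    (hL : P.SolvesHJB L) {T c₁ c₂ c₃ : ℝ} (hT : 0 < T) (hc : 0 < c₁ ∨ 0 < c₂ ∨ 0 < c₃) :
    ∃ μ > 0, ∀ (t₀ : ℝ) (t₁ : EReal) (s : Signals n p b), 0 ≤ t₀ → P.IsTrajectory s t₀ t₁ →
      P.IsExciting s T c₁ c₂ c₃ t₀ t₁ → ∀ t ∈ horizon t₀ t₁, t₀ + T ≤ t → ∀ v,
        μ * ‖v‖ ^ 2 ≤ ⟪Ring.inverse (s.Γ t) v, v⟫ := by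
  have hη1 := hP.ηc1_pos
  have hη2 := hP.ηc2_pos
  rcases hc with hc | hc | hc
  · refine ⟨Real.exp (-P.β * T) * (P.ηc1 * c₁), by positivity, fun t₀ t₁ s ht₀ hs he t ht htT v =>
      hs.le_inner_inverse_gain hP hL ht₀ hT hη1.le hc ht htT
        (A := fun τ => P.psi s (s.x τ) τ) (fun τ _ v => P.inner_psi_nonneg s _ τ v)
        (fun τ _ v => hP.psi_le_infoRate s τ v) ?_ v⟩
    have := he.traj (t - T) (by linarith) (by rwa [sub_add_cancel])
    rwa [sub_add_cancel] at this
  -- The pointwise condition is integrated through the constant minorant `c₂ 𝕀`, which contributes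
  -- `T c₂` over a window and is trivially integrable.
  · refine ⟨Real.exp (-P.β * T) * (P.ηc2 * (T * c₂)), by positivity,
      fun t₀ t₁ s ht₀ hs he t ht htT v =>
      hs.le_inner_inverse_gain hP hL ht₀ hT hη2.le (mul_pos hT hc) ht htT
        (A := fun _ => c₂ • (1 : Lin b b)) (fun τ _ v => ?_)
        (fun τ hτ v => ?_) ?_ v⟩
    · rw [smul_apply, one_apply_eq_self, inner_smul_left, conj_trivial]
      exact mul_nonneg hc.le real_inner_self_nonneg
    · have hτh := Icc_subset_horizon ht (show τ ∈ Icc t₀ t from ⟨by linarith [hτ.1], hτ.2.le⟩)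
      exact (mul_le_mul_of_nonneg_left (he.le_inner_meanPsi hτh v) hη2.le).trans
        (hP.meanPsi_le_infoRate s τ v)
    · rw [intervalIntegral.integral_const, sub_sub_cancel, smul_smul]
  · exact ⟨Real.exp (-P.β * T) * (P.ηc2 * c₃), by positivity,
      fun t₀ t₁ s ht₀ hs he t ht htT v =>
      hs.le_inner_inverse_gain hP hL ht₀ hT hη2.le hc ht htT
        (A := P.meanPsi s) (fun τ _ v => P.inner_meanPsi_nonneg s τ v)
        (fun τ _ v => hP.meanPsi_le_infoRate s τ v) (he.le_integral_meanPsi ht htT) v⟩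

/-! ### The critic -/

/-- The correction that drives the critic, before multiplication by the gain. -/
noncomputable def criticDrive (P : ACIL n m p b N) (s : Signals n p b) (t : ℝ) : Vec b :=
  (P.ηc1 * P.del s (s.x t) t / P.rho s (s.x t) t ^ 2) • P.om s (s.x t) t
    + (P.ηc2 / N) •
      ∑ i, (P.del s (P.pt s i t) t / P.rho s (P.pt s i t) t ^ 2) • P.om s (P.pt s i t) t

theorem criticRHS_eq (P : ACIL n m p b N) (s : Signals n p b) (t : ℝ) :
    P.criticRHS s t = -(s.Γ t (P.criticDrive s t)) := by
  simp only [criticRHS, criticDrive, map_add, map_smul]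
  abel

/-- The Lyapunov function `W̃_cᵀ Γ⁻¹ W̃_c` of the critic. -/
noncomputable def lyap (s : Signals n p b) (W : Vec b) (t : ℝ) : ℝ :=
  ⟪Ring.inverse (s.Γ t) (W - s.Wc t), W - s.Wc t⟫

/-- Completing the square at one regressor. -/
theorem two_mul_del_add_sq_le {a δ q c : ℝ} (hq : 1 ≤ q) (hδ : |δ + a| ≤ c) :
    2 * (δ / q * a) + a ^ 2 / q ≤ c ^ 2 := by
  -- Since `2 δ a + a² = (δ + a)² - δ² ≤ c²`, the normalization by `q ≥ 1` only helps.
  have h1 : (δ + a) ^ 2 ≤ c ^ 2 := sq_le_sq' (neg_le_of_abs_le hδ) (le_of_abs_le hδ)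
  have e : 2 * (δ / q * a) + a ^ 2 / q = (2 * δ * a + a ^ 2) / q := by ring
  rw [e, div_le_iff₀ (by linarith)]
  nlinarith [sq_nonneg δ, sq_nonneg c]

/-- The positive term `W̃ᵀ M W̃`, which the growth of `Γ⁻¹` puts into the derivative of `lyap`, is
compensated regressor by regressor by the gradient correction of the critic. Both carry the same
gains and the same normalization `ρ²`. -/
theorem Standing.two_mul_inner_criticDrive_le (hP : P.Standing) {t c : ℝ}
    (hΓ : ∀ v, 0 ≤ ⟪s.Γ t v, v⟫) (W : Vec b)
    (hx : |P.del s (s.x t) t + ⟪P.om s (s.x t) t, W - s.Wc t⟫| ≤ c)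
    (hpt : ∀ i, |P.del s (P.pt s i t) t + ⟪P.om s (P.pt s i t) t, W - s.Wc t⟫| ≤ c) :
    2 * ⟪P.criticDrive s t, W - s.Wc t⟫ + ⟪P.infoRate s t (W - s.Wc t), W - s.Wc t⟫
      ≤ (P.ηc1 + P.ηc2) * c ^ 2 := by
  have h1 := hP.ηc1_pos.le
  have h2 := hP.ηc2_pos.le
  set w := W - s.Wc t
  have e : 2 * ⟪P.criticDrive s t, w⟫ + ⟪P.infoRate s t w, w⟫
      = P.ηc1 * (2 * (P.del s (s.x t) t / P.rho s (s.x t) t ^ 2 * ⟪P.om s (s.x t) t, w⟫)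
          + ⟪P.om s (s.x t) t, w⟫ ^ 2 / P.rho s (s.x t) t ^ 2)
        + P.ηc2 / N * ∑ i, (2 * (P.del s (P.pt s i t) t / P.rho s (P.pt s i t) t ^ 2
              * ⟪P.om s (P.pt s i t) t, w⟫)
            + ⟪P.om s (P.pt s i t) t, w⟫ ^ 2 / P.rho s (P.pt s i t) t ^ 2) := by
    simp only [inner_infoRate_self, inner_psi_self, criticDrive, inner_add_left, inner_smul_left,
      sum_inner, conj_trivial, Finset.sum_add_distrib, ← Finset.mul_sum]
    ring
  rw [e]
  calc _ ≤ P.ηc1 * c ^ 2 + P.ηc2 / N * (N * c ^ 2) := by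
        gcongr
        · exact two_mul_del_add_sq_le (hP.one_le_rho_sq hΓ _) hx
        · refine (Finset.sum_le_card_nsmul _ _ _ fun i _ =>
            two_mul_del_add_sq_le (hP.one_le_rho_sq hΓ _) (hpt i)).trans ?_
          simp
    _ ≤ P.ηc1 * c ^ 2 + P.ηc2 * c ^ 2 := by
        exact add_le_add le_rfl (div_natCast_mul_natCast_mul_le h2 (sq_nonneg c) N)
    _ = _ := by ring

/-- As `W̃' = Γ d` for the drive `d`, the gain cancels against `Γ⁻¹` and `V' = -β V + 2 dᵀ W̃ + W̃ᵀ
M W̃`. The last two terms together are bounded by a constant. -/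
theorem IsTrajectory.lyap_le (hs : P.IsTrajectory s t₀ t₁) (hP : P.Standing)
    {L : Vec n → ℝ} (hL : P.SolvesHJB L) (ht₀ : 0 ≤ t₀) (W : Vec b) {t' t c : ℝ} (ht' : t₀ ≤ t')
    (htt : t' ≤ t) (ht : t ∈ horizon t₀ t₁)
    (hx : ∀ τ ∈ Ico t' t, |P.del s (s.x τ) τ + ⟪P.om s (s.x τ) τ, W - s.Wc τ⟫| ≤ c)
    (hpt : ∀ τ ∈ Ico t' t, ∀ i,
      |P.del s (P.pt s i τ) τ + ⟪P.om s (P.pt s i τ) τ, W - s.Wc τ⟫| ≤ c) :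
    lyap s W t ≤ Real.exp (-P.β * (t - t')) * lyap s W t' + (P.ηc1 + P.ηc2) * c ^ 2 / P.β := by
  have hsub : Icc t' t ⊆ horizon t₀ t₁ :=
    (Icc_subset_Icc_left ht').trans (Icc_subset_horizon ht)
  have h1 := hP.ηc1_pos
  have h2 := hP.ηc2_pos
  have hpd : ∀ τ ∈ Icc t' t, IsPosDefMap (s.Γ τ) := fun τ hτ =>
    hs.isPosDefMap_gain hP hL ht₀ (hsub hτ)
  have hw : ContinuousOn (fun τ => W - s.Wc τ) (Icc t' t) :=
    continuousOn_const.sub (hs.Wc_cont.mono hsub)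
  refine le_exp_mul_add_of_deriv_right_le (V := lyap s W) hP.β_pos
    (((continuousOn_inverse (hs.Γ_cont.mono hsub) hpd).clm_apply hw).inner hw)
    (V' := fun τ => ⟪Ring.inverse (s.Γ τ) (W - s.Wc τ), s.Γ τ (P.criticDrive s τ)⟫
      + ⟪(-(P.β • Ring.inverse (s.Γ τ)) + P.infoRate s τ) (W - s.Wc τ)
        + Ring.inverse (s.Γ τ) (s.Γ τ (P.criticDrive s τ)), W - s.Wc τ⟫)
    (fun τ hτ => ?_) (fun τ hτ => ?_) (by positivity) t ⟨htt, le_rfl⟩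
  · have hτ' := Ico_subset_Icc_self hτ
    have hwd : HasDerivWithinAt (fun τ => W - s.Wc τ) (s.Γ τ (P.criticDrive s τ)) (Ici τ) τ := by
      have := (hs.critic τ (hsub hτ') (hs.mem_interior_Icc hP (hsub hτ'))).const_sub W
      rwa [criticRHS_eq, neg_neg] at this
    exact ((hasDerivWithinAt_inverse_of_riccati (hpd τ hτ').isUnit
      (hs.hasDerivWithinAt_gain hP (hsub hτ'))).clm_apply hwd).inner ℝ hwd
  · have hτ' := Ico_subset_Icc_self hτ
    have hp := hpd τ hτ'
    have key := hP.two_mul_inner_criticDrive_le hp.inner_nonneg W (hx τ hτ) (hpt τ hτ)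
    have e1 : ⟪Ring.inverse (s.Γ τ) (W - s.Wc τ), s.Γ τ (P.criticDrive s τ)⟫
        = ⟪P.criticDrive s τ, W - s.Wc τ⟫ := by
      rw [hp.inner_inverse_comm, hp.inverse_apply, real_inner_comm]
    rw [e1, hp.inverse_apply]
    simp only [lyap, inner_add_left, add_apply, neg_apply, smul_apply, inner_neg_left,
      inner_smul_left, conj_trivial]
    linarith

end ACIL
-- Uniform ultimate boundedness
namespace ACIL

variable {n m p b N : ℕ} {P : ACIL n m p b N}

/-- The critic, actor and identifier errors are uniformly ultimately bounded under excitation. -/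
theorem Standing.exists_ultimate_bound (hP : P.Standing) {L : Vec n → ℝ} (hL : P.SolvesHJB L)
    (W : Vec b) {αlo αhi : ℝ → ℝ} (hαlo : IsClassKInfty αlo) (hαhi : IsClassK αhi)
    {kθ : ℝ} (hkθ : 0 < kθ) {T c₁ c₂ c₃ : ℝ} (hT : 0 < T) (hc : 0 < c₁ ∨ 0 < c₂ ∨ 0 < c₃) :
    ∃ bu : ℝ, 0 < bu ∧ ∀ K : Set (Vec n), IsCompact K → K ⊆ interior P.C → ∀ a : ℝ, 0 < a →
      ∃ Tu : ℝ, 0 ≤ Tu ∧ ∀ (t₀ : ℝ) (t₁ : EReal) (s : Signals n p b), 0 ≤ t₀ →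
        P.IsTrajectory s t₀ t₁ →
        P.IsIdentified s αlo αhi kθ t₀ t₁ →
        P.IsExciting s T c₁ c₂ c₃ t₀ t₁ →
        s.x t₀ ∈ K → ‖W - s.Wc t₀‖ ≤ a → ‖P.θ - s.θh t₀‖ ≤ a →
        ∀ t ∈ horizon t₀ t₁, t₀ + Tu ≤ t →
          ‖W - s.Wc t‖ ≤ bu ∧ ‖W - s.Wa t‖ ≤ bu ∧ ‖P.θ - s.θh t‖ ≤ bu := by
  obtain ⟨B₁, hB₁⟩ := hP.exists_barrier_level
  obtain ⟨KX, hKX, hKXC, hX⟩ := hP.X_mem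
  obtain ⟨μ, hμ, hinv⟩ := hP.exists_le_inner_inverse_gain hL hT hc
  have hregion : ∀ c : ℝ, IsCompact ({x | x ∈ interior P.C ∧ P.B x ≤ c} ∪ KX) ∧
      {x | x ∈ interior P.C ∧ P.B x ≤ c} ∪ KX ⊆ interior P.C := fun c =>
    ⟨(hP.isCompact_sublevel c).union hKX, union_subset (fun x hx => hx.1) hKXC⟩
  have hβ := hP.β_pos
  have hη1 := hP.ηc1_pos
  have hη2 := hP.ηc2_pos
  have hWa := hP.Wabar_pos
  -- The residual bound for the eventual regime, with barrier at most `B₁` and parameter error at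
  -- most one. It is fixed before `K` and `a`, which makes the ultimate bound independent of them.
  obtain ⟨d₀, hd₀, hdel₀⟩ := hP.exists_del_bound hL W (hregion B₁).1 (hregion B₁).2 1
  set D₀ := (P.ηc1 + P.ηc2) * d₀ ^ 2 / P.β with hD₀
  have hD₀nn : 0 ≤ D₀ := by positivity
  -- The three summands bound the critic, actor and parameter errors respectively.
  refine ⟨Real.sqrt ((1 + D₀) / μ) + (‖W‖ + P.Wabar) + 1, by positivity,
    fun K hK hKC a ha => ?_⟩
  obtain ⟨bK, hbK⟩ := hK.exists_bound_of_continuousOn (hP.B_contDiff.continuousOn.mono hKC)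
  obtain ⟨M, Tθ, hTθ, hθ⟩ := P.exists_identifier_bound hαlo hαhi hkθ ha
  obtain ⟨d₁, hd₁, hdel₁⟩ := hP.exists_del_bound hL W (hregion (max B₁ bK)).1
    (hregion (max B₁ bK)).2 M
  set D₁ := (P.ηc1 + P.ηc2) * d₁ ^ 2 / P.β with hD₁
  have hD₁nn : 0 ≤ D₁ := by positivity
  set V₀ := ‖Ring.inverse P.Γ₀‖ * a ^ 2 + D₁ with hV₀
  have hV₀nn : 0 ≤ V₀ := by positivity
  -- By then the barrier, falling at unit rate from at most `bK`, has reached `B₁`, and the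
  -- parameter error is at most one.
  set T₁ := max (bK - B₁) 0 + Tθ with hT₁
  have hT₁nn : 0 ≤ T₁ := add_nonneg (le_max_right _ _) hTθ
  -- After the transient, the time `V₀ / β` reduces the remainder of `V₀` below one, by `V₀ ≤ β s ≤
  -- exp (β s)`. The summand `T` ensures that a full excitation window has passed.
  refine ⟨T₁ + V₀ / P.β + T, by positivity, fun t₀ t₁ s ht₀ hs hid he hx₀ hWc₀ hθ₀ t ht htT => ?_⟩
  have hdecay : 0 ≤ V₀ / P.β := by positivity
  have hθs := hθ t₀ t₁ s hid hθ₀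
  have hBx₀ : P.B (s.x t₀) ≤ bK := (le_abs_self _).trans (hbK _ hx₀)
  have hsub := Icc_subset_horizon ht
  have hBx : ∀ τ ∈ Icc t₀ t, P.B (s.x τ) ≤ max B₁ (P.B (s.x t₀) - (τ - t₀)) := fun τ hτ =>
    hs.B_le_of_mem hP hB₁ (hsub hτ)
  have hpts : ∀ τ ∈ Icc t₀ t, ∀ i, P.pt s i τ ∈ KX := fun τ hτ i =>
    hX i _ (hs.mem_interior hP (hsub hτ)) τ (ht₀.trans hτ.1)
  have htransient : lyap s W (t₀ + T₁) ≤ V₀ := by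
    have hmem : t₀ + T₁ ∈ Icc t₀ t := ⟨by linarith, by linarith⟩
    have hb : ∀ τ ∈ Ico t₀ (t₀ + T₁), ∀ y ∈ {x | x ∈ interior P.C ∧ P.B x ≤ max B₁ bK} ∪ KX,
        |P.del s y τ + ⟪P.om s y τ, W - s.Wc τ⟫| ≤ d₁ := fun τ hτ y hy => by
      have hτ' : τ ∈ Icc t₀ t := ⟨hτ.1, hτ.2.le.trans hmem.2⟩
      exact (hdel₁ s τ (hs.norm_Wa_le_of_mem hP (hsub hτ')) (hθs τ (hsub hτ')).1 y hy).2
    have h := hs.lyap_le hP hL ht₀ W le_rfl hmem.1 (hsub hmem) (c := d₁)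
      (fun τ hτ => hb τ hτ _ (Or.inl ?_)) (fun τ hτ i => hb τ hτ _ (Or.inr ?_))
    · have h0 : lyap s W t₀ ≤ ‖Ring.inverse P.Γ₀‖ * a ^ 2 := by
        rw [lyap, hs.Γ_init, sq, ← mul_assoc]
        refine (real_inner_le_norm _ _).trans ?_
        gcongr
        exact (ContinuousLinearMap.le_opNorm _ _).trans (by gcongr)
      have h0nn : 0 ≤ lyap s W t₀ :=
        (hs.isPosDefMap_gain hP hL ht₀ (hsub ⟨le_rfl, ht.1⟩)).inner_inverse_nonneg _
      have hexp : Real.exp (-P.β * (t₀ + T₁ - t₀)) ≤ 1 := by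
        rw [Real.exp_le_one_iff]
        nlinarith
      nlinarith
    · have hτ' : τ ∈ Icc t₀ t := ⟨hτ.1, hτ.2.le.trans hmem.2⟩
      exact ⟨hs.mem_interior hP (hsub hτ'), (hBx τ hτ').trans
        (max_le_max_left _ (by linarith [hτ.1]))⟩
    · exact hpts τ ⟨hτ.1, hτ.2.le.trans hmem.2⟩ i
  have hultimate : lyap s W t ≤ 1 + D₀ := by
    have hsub' : Ico (t₀ + T₁) t ⊆ Icc t₀ t := fun τ hτ => ⟨by linarith [hτ.1], hτ.2.le⟩
    have hb : ∀ τ ∈ Ico (t₀ + T₁) t, ∀ y ∈ {x | x ∈ interior P.C ∧ P.B x ≤ B₁} ∪ KX,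
        |P.del s y τ + ⟪P.om s y τ, W - s.Wc τ⟫| ≤ d₀ := fun τ hτ y hy => by
      have hτ' := hsub (hsub' hτ)
      exact (hdel₀ s τ (hs.norm_Wa_le_of_mem hP hτ') ((hθs τ hτ').2
        (by linarith [hτ.1, le_max_right (bK - B₁) 0])) y hy).2
    have h := hs.lyap_le hP hL ht₀ W (t' := t₀ + T₁) (by linarith) (by linarith) ht (c := d₀)
      (fun τ hτ => hb τ hτ _ (Or.inl ?_))
      (fun τ hτ i => hb τ hτ _ (Or.inr (hpts τ (hsub' hτ) i)))
    · have hexp : Real.exp (-P.β * (t - (t₀ + T₁))) * V₀ ≤ 1 := by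
        have h1 : V₀ ≤ P.β * (t - (t₀ + T₁)) := by
          calc V₀ = P.β * (V₀ / P.β) := by field_simp
            _ ≤ _ := by gcongr; linarith
        have h2 : V₀ ≤ Real.exp (P.β * (t - (t₀ + T₁))) := by
          linarith [Real.add_one_le_exp (P.β * (t - (t₀ + T₁)))]
        calc _ ≤ Real.exp (-P.β * (t - (t₀ + T₁))) * Real.exp (P.β * (t - (t₀ + T₁))) := by gcongr
          _ = 1 := by rw [← Real.exp_add]; simp
      have := mul_le_mul_of_nonneg_left htransient (Real.exp_pos (-P.β * (t - (t₀ + T₁)))).le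
      linarith
    · refine ⟨hs.mem_interior hP (hsub (hsub' hτ)), (hBx τ (hsub' hτ)).trans
        (max_le le_rfl ?_)⟩
      linarith [hτ.1, le_max_left (bK - B₁) 0]
  have hsqrt := Real.sqrt_nonneg ((1 + D₀) / μ)
  have hWn := norm_nonneg W
  refine ⟨?_, ?_, ?_⟩
  · have h := (hinv t₀ t₁ s ht₀ hs he t ht (by linarith) (W - s.Wc t)).trans hultimate
    have h' : ‖W - s.Wc t‖ ≤ Real.sqrt ((1 + D₀) / μ) :=
      Real.le_sqrt_of_sq_le (by rwa [le_div_iff₀ hμ, mul_comm])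
    linarith
  · have := (norm_sub_le W (s.Wa t)).trans (add_le_add le_rfl (hs.norm_Wa_le_of_mem hP ht))
    linarith
  · have := (hθs t ht).2 (by linarith [le_max_right (bK - B₁) 0])
    linarith

end ACIL

theorem theorem2 {n m p b N : ℕ} (P : ACIL n m p b N) (hP : P.Standing)
    -- value function, ideal weight, reconstruction error
    (L : Vec n → ℝ) (hL : P.SolvesHJB L)
    (W : Vec b) (ε : Vec n → ℝ) (hW : P.IsIdealWeight L W ε)
    -- comparison functions and rate of the identifier
    (αlo αhi : ℝ → ℝ) (hαlo : IsClassKInfty αlo) (hαhi : IsClassK αhi)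
    (kθ : ℝ) (hkθ : 0 < kθ)
    -- excitation constants
    (T c₁ c₂ c₃ : ℝ) (hT : 0 < T) (hc₁ : 0 ≤ c₁) (hc₂ : 0 ≤ c₂) (hc₃ : 0 ≤ c₃)
    (hc : 0 < c₁ ∨ 0 < c₂ ∨ 0 < c₃) :
    -- forward invariance: a trajectory started in the safe set never leaves it
    (∀ (t₀ : ℝ) (t₁ : EReal) (s : Signals n p b), 0 ≤ t₀ → P.IsTrajectory s t₀ t₁ →
      ∀ t ∈ horizon t₀ t₁, s.x t ∈ interior P.C) ∧
    -- boundedness of the state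
    (∃ bx : ℝ, ∀ (t₀ : ℝ) (t₁ : EReal) (s : Signals n p b), 0 ≤ t₀ → P.IsTrajectory s t₀ t₁ →
      ∀ t ∈ horizon t₀ t₁, ‖s.x t‖ ≤ bx) ∧
    -- uniform ultimate boundedness of the critic, actor and identifier errors
    (∃ bu : ℝ, 0 < bu ∧ ∀ K : Set (Vec n), IsCompact K → K ⊆ interior P.C → ∀ a : ℝ, 0 < a →
      ∃ Tu : ℝ, 0 ≤ Tu ∧ ∀ (t₀ : ℝ) (t₁ : EReal) (s : Signals n p b), 0 ≤ t₀ →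
        P.IsTrajectory s t₀ t₁ →
        P.IsIdentified s αlo αhi kθ t₀ t₁ →
        P.IsExciting s T c₁ c₂ c₃ t₀ t₁ →
        (P.crossMatrix W kθ c₂ (ACIL.gainLo s t₀ t₁) (ACIL.gainHi s t₀ t₁)).PosSemidef →
        s.x t₀ ∈ K → ‖W - s.Wc t₀‖ ≤ a → ‖W - s.Wa t₀‖ ≤ a → ‖P.θ - s.θh t₀‖ ≤ a →
        ∀ t ∈ horizon t₀ t₁, t₀ + Tu ≤ t →
          ‖W - s.Wc t‖ ≤ bu ∧ ‖W - s.Wa t‖ ≤ bu ∧ ‖P.θ - s.θh t‖ ≤ bu) := by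
  refine ⟨fun t₀ t₁ s _ hs t ht => hs.mem_interior hP ht, ?_, ?_⟩
  · obtain ⟨bx, hbx⟩ := hP.isCompact_C.isBounded.exists_norm_le
    exact ⟨bx, fun t₀ t₁ s _ hs t ht => hbx _ (interior_subset (hs.mem_interior hP ht))⟩
  · obtain ⟨bu, hbu, h⟩ := hP.exists_ultimate_bound hL W hαlo hαhi hkθ hT hc
    refine ⟨bu, hbu, fun K hK hKC a ha => ?_⟩
    obtain ⟨Tu, hTu, h⟩ := h K hK hKC a ha
    exact ⟨Tu, hTu, fun t₀ t₁ s ht₀ hs hid he _ hx₀ hWc₀ _ hθ₀ =>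
      h t₀ t₁ s ht₀ hs hid he hx₀ hWc₀ hθ₀⟩
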